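/- Graphs are finite, simple and undirected; a matching of a graph $G=(V,E)$ is a set of pairwise disjoint edges. For $K\ge 1$, the $K$-subdivision $\mathrm{sub}(H,K)$ of a graph $H$ is obtained by replacing every edge of $H$ by a path of length $K$ with the same end vertices, all intermediate vertices being fresh. For a (possibly infinite) set $\mathcal F$ of graphs, $\#\mathrm{Matching}(\mathcal F)$ is the problem: given $G\in\mathcal F$, compute the number of matchings of $G$. $\mathrm{PrMatching}(\mathcal F)$ is the problem: given $G=(V,E)\in\mathcal F$ and a function $\pi\colon E\to[0,1]\cap\mathbb Q$, compute $$\Pr\nolimits_{\text{matching}}(G,\pi)=\sum_{M\text{ matching of }G}\ \prod_{e\in M}\pi(e)\prod_{e\in E\setminus M}(1-\pi(e)),$$ the probability that the random edge set, in which every edge $e$ is kept independently with probability $\pi(e)$, is a matching. Proposition. Fix an integer $K\ge 7$. Then, for every set $\mathcal F$ of graphs, $\#\mathrm{Matching}(\mathcal F)$ reduces in (deterministic) polynomial time, by a Turing reduction, to $\mathrm{PrMatching}(\mathcal G)$, where $\mathcal G=\{\mathrm{sub}(H,K)\mid H\in\mathcal F\}$: there is an algorithm that solves $\#\mathrm{Matching}(\mathcal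 F)$ in polynomial time when it has access to an oracle for $\mathrm{PrMatching}(\mathcal G)$. -/

import Mathlib

namespace MatchRed

/-! ### Graphs, matchings, subdivisions -/

/-- A finite undirected simple graph `(V, E)`; vertices are named by natural numbers. -/
structure FinGraph where
  V : Finset ℕ
  E : Finset (Sym2 ℕ)
  mem_V : ∀ e ∈ E, ∀ v ∈ e, v ∈ V
  loopless : ∀ e ∈ E, ¬ e.IsDiag

/-- `M` is a set of pairwise disjoint edges. -/
def PairwiseDisjointEdges (M : Finset (Sym2 ℕ)) : Prop :=
  ∀ e ∈ M, ∀ f ∈ M, e ≠ f → ∀ v, v ∈ e → v ∉ f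

open Classical in
/-- The finite set of all matchings of `G`. -/
noncomputable def FinGraph.matchings (G : FinGraph) : Finset (Finset (Sym2 ℕ)) :=
  G.E.powerset.filter PairwiseDisjointEdges

/-- The number of matchings of `G`. -/
noncomputable def FinGraph.numMatchings (G : FinGraph) : ℕ := G.matchings.card

/-- Probability of drawing exactly the edge set `M` when each edge `e` of `G` is kept
independently with probability `π e`. -/
def FinGraph.prSubset (G : FinGraph) (π : Sym2 ℕ → ℚ) (M : Finset (Sym2 ℕ)) : ℚ :=
  (∏ e ∈ M, π e) * ∏ e ∈ G.E \ M, (1 - π e)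

/-- Probability that the random edge set of the probabilistic graph `(G, π)` is a matching. -/
noncomputable def FinGraph.prMatching (G : FinGraph) (π : Sym2 ℕ → ℚ) : ℚ :=
  ∑ M ∈ G.matchings, G.prSubset π M

/-- All vertices of `G` are smaller than `G.freshBase`. -/
def FinGraph.freshBase (G : FinGraph) : ℕ := G.V.sup id + 1

/-- The `i`-th vertex (`0 ≤ i ≤ K`) on the path of length `K` replacing the edge `e = {x, y}`,
`x < y`: it is `x` for `i = 0`, `y` for `i = K`, and otherwise a fresh vertex whose name is
determined injectively by `x, y, i`. -/
def FinGraph.pathVertex (G : FinGraph) (K : ℕ) (e : Sym2 ℕ) (i : ℕ) : ℕ :=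
  if i = 0 then e.inf
  else if i < K then G.freshBase + Nat.pair (Nat.pair e.inf e.sup) i
  else e.sup

theorem FinGraph.lt_freshBase (G : FinGraph) {v : ℕ} (hv : v ∈ G.V) : v < G.freshBase :=
  Nat.lt_succ_of_le (Finset.le_sup (f := id) hv)

theorem FinGraph.pathVertex_ne (G : FinGraph) (K : ℕ) {e : Sym2 ℕ} (he : e ∈ G.E)
    {i : ℕ} (hi : i < K) : G.pathVertex K e i ≠ G.pathVertex K e (i + 1) := by
  have h : e.inf < G.freshBase ∧ e.sup < G.freshBase ∧ e.inf ≠ e.sup := by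
    have hV := G.mem_V e he
    have hl := G.loopless e he
    induction e with
    | _ x y =>
      have hx := G.lt_freshBase (hV x (by simp))
      have hy := G.lt_freshBase (hV y (by simp))
      have hxy : x ≠ y := by simpa using hl
      rw [Sym2.inf_mk, Sym2.sup_mk]
      rcases le_total x y with h | h <;> simp [h, hx, hy, hxy, hxy.symm]
  obtain ⟨h1, h2, h3⟩ := h
  have h4 : Nat.pair (Nat.pair e.inf e.sup) i ≠ Nat.pair (Nat.pair e.inf e.sup) (i + 1) := by
    intro h
    have := (Nat.pair_eq_pair.1 h).2
    omega
  simp only [FinGraph.pathVertex]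
  split_ifs <;> first | contradiction | omega

/-- `G.sub K` is the `K`-subdivision of `G` (for `K ≥ 1`): each edge is replaced by a path of
length `K` with the same end vertices, all intermediate vertices being fresh. -/
def FinGraph.sub (G : FinGraph) (K : ℕ) : FinGraph where
  V := G.V ∪ G.E.biUnion fun e => (Finset.range (K + 1)).image (G.pathVertex K e)
  E := G.E.biUnion fun e =>
    (Finset.range K).image fun i => s(G.pathVertex K e i, G.pathVertex K e (i + 1))
  mem_V := by
    intro f hf v hv
    simp only [Finset.mem_biUnion, Finset.mem_image, Finset.mem_range] at hf
    obtain ⟨e, he, i, hi, rfl⟩ := hf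
    refine Finset.mem_union_right _ (Finset.mem_biUnion.2 ⟨e, he, ?_⟩)
    rcases Sym2.mem_iff.1 hv with rfl | rfl
    · exact Finset.mem_image_of_mem _ (Finset.mem_range.2 (by omega))
    · exact Finset.mem_image_of_mem _ (Finset.mem_range.2 (by omega))
  loopless := by
    intro f hf
    simp only [Finset.mem_biUnion, Finset.mem_image, Finset.mem_range] at hf
    obtain ⟨e, he, i, hi, rfl⟩ := hf
    simpa using G.pathVertex_ne K he hi

/-! ### Random access machines with an oracle, under the logarithmic cost measure -/

/-- The length of a word of natural numbers, each written in binary and followed by a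
separator. -/
def wordSize (w : List ℕ) : ℕ := (w.map fun a => a.size + 1).sum

/-- The memory of the machine: registers (named by numbers) and arrays (named by numbers), all
holding natural numbers. A program mentions finitely many registers and arrays. -/
structure Mem where
  reg : ℕ → ℕ
  arr : ℕ → ℕ → ℕ

/-- Arithmetic operations: truncated subtraction, division rounded down. -/
inductive BinOp
  | add
  | sub
  | mul
  | div

/-- The value of an operation. -/
def BinOp.eval : BinOp → ℕ → ℕ → ℕ
  | .add, a, b => a + b
  | .sub, a, b => a - b
  | .mul, a, b => a * b
  | .div, a, b => a / b

/-- Arithmetic expressions: constants, registers, array reads with a computed index, and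
arithmetic operations. -/
inductive AExp
  | const (n : ℕ)
  | reg (x : ℕ)
  | read (a : ℕ) (i : AExp)
  | op (o : BinOp) (l r : AExp)

/-- The value of an expression. -/
def AExp.eval (s : Mem) : AExp → ℕ
  | .const n => n
  | .reg x => s.reg x
  | .read a i => s.arr a (i.eval s)
  | .op o l r => o.eval (l.eval s) (r.eval s)

/-- Logarithmic cost of evaluating an expression: every elementary operation costs one plus the
bit lengths of the numbers (operands, addresses, contents) that it handles. -/
def AExp.cost (s : Mem) : AExp → ℕ
  | .const n => 1 + n.size
  | .reg x => 1 + (s.reg x).size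
  | .read a i => i.cost s + (1 + (i.eval s).size + (s.arr a (i.eval s)).size)
  | .op _ l r => l.cost s + r.cost s + (1 + (l.eval s).size + (r.eval s).size)

/-- Programs. Tests are for being nonzero. `query a n b k` submits the first `reg n` entries of
the array `a` to the oracle; the answer is written to the array `b`, its length to the
register `k`. -/
inductive Cmd
  | skip
  | assign (x : ℕ) (e : AExp)
  | store (a : ℕ) (i e : AExp)
  | seq (c d : Cmd)
  | ite (e : AExp) (c d : Cmd)
  | loop (e : AExp) (c : Cmd)
  | query (a n b k : ℕ)

/-- Update of a register. -/
def Mem.setReg (s : Mem) (x v : ℕ) : Mem := { s with reg := Function.update s.reg x v }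

/-- Update of an array entry. -/
def Mem.setEntry (s : Mem) (a i v : ℕ) : Mem :=
  { s with arr := Function.update s.arr a (Function.update (s.arr a) i v) }

/-- Put the word `w` into the array `a` (padded by zeros) and its length into the
register `k`. -/
def Mem.setWord (s : Mem) (a k : ℕ) (w : List ℕ) : Mem where
  reg := Function.update s.reg k w.length
  arr := Function.update s.arr a fun i => w.getD i 0

/-- The word formed by the first `reg n` entries of the array `a`. -/
def Mem.getWord (s : Mem) (a n : ℕ) : List ℕ := (List.range (s.reg n)).map (s.arr a)

/-- `Exec O c s s' t`: with oracle `O`, the program `c` started in memory `s` halts in memory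
`s'` after time `t` (logarithmic cost). A query costs the lengths of the question and of the
answer. -/
inductive Exec (O : List ℕ → List ℕ) : Cmd → Mem → Mem → ℕ → Prop
  | skip (s : Mem) : Exec O .skip s s 1
  | assign (s : Mem) (x : ℕ) (e : AExp) :
      Exec O (.assign x e) s (s.setReg x (e.eval s)) (e.cost s + 1 + (e.eval s).size)
  | store (s : Mem) (a : ℕ) (i e : AExp) :
      Exec O (.store a i e) s (s.setEntry a (i.eval s) (e.eval s))
        (i.cost s + e.cost s + 1 + (i.eval s).size + (e.eval s).size)
  | seq {c d : Cmd} {s s' s'' : Mem} {t t' : ℕ} :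
      Exec O c s s' t → Exec O d s' s'' t' → Exec O (.seq c d) s s'' (t + t' + 1)
  | iteTrue {e : AExp} {c d : Cmd} {s s' : Mem} {t : ℕ} :
      e.eval s ≠ 0 → Exec O c s s' t → Exec O (.ite e c d) s s' (e.cost s + t + 1)
  | iteFalse {e : AExp} {c d : Cmd} {s s' : Mem} {t : ℕ} :
      e.eval s = 0 → Exec O d s s' t → Exec O (.ite e c d) s s' (e.cost s + t + 1)
  | loopStop {e : AExp} {c : Cmd} {s : Mem} :
      e.eval s = 0 → Exec O (.loop e c) s s (e.cost s + 1)
  | loopStep {e : AExp} {c : Cmd} {s s' s'' : Mem} {t t' : ℕ} :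
      e.eval s ≠ 0 → Exec O c s s' t → Exec O (.loop e c) s' s'' t' →
      Exec O (.loop e c) s s'' (e.cost s + t + t' + 1)
  | query (s : Mem) (a n b k : ℕ) :
      Exec O (.query a n b k) s (s.setWord b k (O (s.getWord a n)))
        (wordSize (s.getWord a n) + wordSize (O (s.getWord a n)) + 1)

/-- The initial memory: the input word is in array `0`, its length in register `0`, all other
entries are zero. -/
def initMem (w : List ℕ) : Mem := Mem.setWord ⟨fun _ => 0, fun _ _ => 0⟩ 0 0 w

/-- A computational problem, given as the relation between (words encoding) valid instances
and (words encoding) their answers. -/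
abbrev Problem : Type := List ℕ → List ℕ → Prop

/-- `O` answers all valid instances of `P` correctly; nothing is known about its answers to
other words. -/
def Solves (O : List ℕ → List ℕ) (P : Problem) : Prop := ∀ w o, P w o → O w = o

/-- `P` reduces to `Q` by a polynomial-time Turing reduction: one program solves `P` in
polynomial time (including the time to write the output, which is the word in array `0` of
length register `0`) when given any oracle for `Q`. -/
def PolyTimeTuringReduces (P Q : Problem) : Prop :=
  ∃ (c : Cmd) (p : Polynomial ℕ), ∀ O : List ℕ → List ℕ, Solves O Q →
    ∀ w o, P w o → ∃ (s : Mem) (t : ℕ),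
      Exec O c (initMem w) s t ∧ s.getWord 0 0 = o ∧ t + wordSize o ≤ p.eval (wordSize w)

/-! ### The two problems -/

/-- The word `w` encodes `G`: the number of vertices, the vertices in some order, the number of
edges, the two ends of each edge, in some order. -/
def EncodesGraph (w : List ℕ) (G : FinGraph) : Prop :=
  ∃ (vs : List ℕ) (es : List (ℕ × ℕ)),
    vs.Nodup ∧ vs.toFinset = G.V ∧
    (es.map fun p => s(p.1, p.2)).Nodup ∧ (es.map fun p => s(p.1, p.2)).toFinset = G.E ∧
    w = vs.length :: vs ++ es.length :: es.flatMap fun p => [p.1, p.2]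

/-- The word `w` encodes the probabilistic graph `(G, π)`: as for graphs, but the two ends `x`,
`y` of each edge are followed by a numerator `a` and a denominator `b` of its probability. -/
def EncodesProbGraph (w : List ℕ) (G : FinGraph) (π : Sym2 ℕ → ℚ) : Prop :=
  ∃ (vs : List ℕ) (es : List (ℕ × ℕ × ℕ × ℕ)),
    vs.Nodup ∧ vs.toFinset = G.V ∧
    (es.map fun p => s(p.1, p.2.1)).Nodup ∧ (es.map fun p => s(p.1, p.2.1)).toFinset = G.E ∧
    (∀ x y a b, (x, y, a, b) ∈ es → b ≠ 0 ∧ π s(x, y) = (a : ℚ) / (b : ℚ)) ∧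
    w = vs.length :: vs ++ es.length :: es.flatMap fun p => [p.1, p.2.1, p.2.2.1, p.2.2.2]

/-- Counting matchings on the graph family `F`: given `G ∈ F`, output its number of
matchings. -/
def CountMatching (F : Set FinGraph) : Problem := fun w o =>
  ∃ G ∈ F, EncodesGraph w G ∧ o = [G.numMatchings]

/-- The problem PrMatching on the graph family `F`: given a graph `G ∈ F` with rational edge
probabilities, output the probability of a matching as a fraction in lowest terms. -/
def PrMatching (F : Set FinGraph) : Problem := fun w o =>
  ∃ G ∈ F, ∃ π : Sym2 ℕ → ℚ, (∀ e ∈ G.E, 0 ≤ π e ∧ π e ≤ 1) ∧ EncodesProbGraph w G π ∧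
    o = [(G.prMatching π).num.toNat, (G.prMatching π).den]

end MatchRed

/-!
One oracle query suffices. Let `m` be the number of edges of `H`, let `n = K - 1`, `r = n % 3` and
`c = 2 ^ r`. Give all paths of the subdivision the same edge probabilities
`a i / (a i + b i)`, `i = 0, …, n`, with positive integers `a i`, `b i`. The probability of a
matching, multiplied by the product `D` of all the denominators `a i + b i`, is the weighted sum
`W` of the matchings of the subdivision, where chosen edges at position `i` weigh `a i`, and all
others `b i`.

Sorting the matchings of the subdivision by the end edges that they use on the paths
(`FinGraph.weightSum_sub`) turns `W` into a sum of products of path sums (`pathSum`), one for each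
edge of `H`. The path sums of a path with `n + 1` edges form the `2 × 2` matrix
`E 0 * J * E 1 * J * ⋯ * J * E n`, where `E i` is diagonal with entries `b i`, `a i`, and
`J` has the rows `1 1` and `1 0`. If this matrix were `c` times the identity, only those terms
would survive in which each path uses both or none of its end edges; these correspond to the
matchings of `H`, and `W` would be `c ^ m` times their number (`FinGraph.weightSum_sub_eq`).

Nonnegative weights cannot achieve this, but integers can: four edges with
`(b, a) = (1, -2), (1, 1), (1, -2), (1, 1)` contribute the matrix `2`, and three edges with
`(b, a) = (-1, 1)` contribute the identity. Every `n ≥ 6` is of the form `4 * r + 3 * k`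
(`pathSum_eq_ite`). The negative weights are made positive by working modulo `q + 1`, where
`q = (2 * c) ^ m` represents `-1`. Since `c ^ m` times the number of matchings is at most
`c ^ m * 2 ^ m = q`, it is the remainder of `W` modulo `q + 1` (`FinGraph.numMatchings_eq`).

For the machine, `wp` is a weakest precondition calculus that also records a bound `N` for loop
passes and word lengths, and a bound `B` for the bit lengths of all numbers written. Its soundness
theorem `exists_exec_of_wp` yields an execution whose time is at most `B + 1` times a polynomial in
`N` that depends on the program only.
-/

namespace MatchRed
open Finset

/-! ### Matchings of a path with prescribed use of the two end edges -/

section Path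
variable {R : Type*} [CommSemiring R]

/-- `X` contains no two consecutive numbers, that is, the edges of a path with positions in `X`
form a matching of the path. -/
def Sparse (X : Finset ℕ) : Prop := ∀ i ∈ X, i + 1 ∉ X

open Classical in
/-- The total weight of the matchings of a path with the `n + 1` edges `0, …, n` that contain the
first edge iff `x`, and the last edge iff `y`. Edge `i` contributes the factor `a i` if it is
chosen and `b i` otherwise. -/
noncomputable def pathSum (a b : ℕ → R) (n : ℕ) (x y : Bool) : R :=
  ∑ X ∈ (range (n + 1)).powerset,
    if Sparse X ∧ decide (0 ∈ X) = x ∧ decide (n ∈ X) = y then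
      (∏ i ∈ X, a i) * ∏ i ∈ range (n + 1) \ X, b i
    else 0

theorem pathSum_zero (a b : ℕ → R) (x y : Bool) :
    pathSum a b 0 x y = if x = y then (if x then a 0 else b 0) else 0 := by
  have h : (range (0 + 1)).powerset = {∅, {0}} := by decide
  have h0 : Sparse ∅ := by simp [Sparse]
  have h1 : Sparse {0} := by simp [Sparse]
  rw [pathSum, h, sum_pair (by simp)]
  cases x <;> cases y <;> simp [h0, h1]

theorem sparse_insert_iff {n : ℕ} {X : Finset ℕ} (hX : X ⊆ range (n + 1)) :
    Sparse (insert (n + 1) X) ↔ Sparse X ∧ n ∉ X := by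
  constructor
  · intro h
    refine ⟨fun i hi h' => h i (mem_insert_of_mem hi) (mem_insert_of_mem h'), fun hn => ?_⟩
    exact h n (mem_insert_of_mem hn) (mem_insert_self _ _)
  · rintro ⟨h, hn⟩ i hi h'
    have hlt : ∀ j ∈ X, j < n + 1 := fun j hj => mem_range.1 (hX hj)
    rcases mem_insert.1 hi with rfl | hi
    · rcases mem_insert.1 h' with h' | h'
      · omega
      · have := hlt _ h'; omega
    · rcases mem_insert.1 h' with h' | h'
      · exact hn (Nat.succ_injective h' ▸ hi)
      · exact h i hi h'

theorem pathSum_succ_true (a b : ℕ → R) (n : ℕ) (x : Bool) :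
    pathSum a b (n + 1) x true = a (n + 1) * pathSum a b n x false := by
  have hn : n + 1 ∉ range (n + 1) := by simp
  rw [pathSum, range_add_one (n := n + 1), sum_powerset_insert hn, pathSum, mul_sum]
  rw [sum_eq_zero, zero_add]
  · refine sum_congr rfl fun X hX => ?_
    have hX := mem_powerset.1 hX
    have hnX : n + 1 ∉ X := fun h => hn (hX h)
    rw [sparse_insert_iff hX, insert_sdiff_insert, sdiff_insert_of_notMem hn,
      prod_insert hnX, mul_ite, mul_zero, mul_assoc]
    congr 1
    simp [and_assoc, and_comm]
  · intro X hX
    have hnX : n + 1 ∉ X := fun h => hn (mem_powerset.1 hX h)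
    simp [hnX]

theorem pathSum_succ_false (a b : ℕ → R) (n : ℕ) (x : Bool) :
    pathSum a b (n + 1) x false =
      b (n + 1) * (pathSum a b n x false + pathSum a b n x true) := by
  have hn : n + 1 ∉ range (n + 1) := by simp
  rw [pathSum, range_add_one (n := n + 1), sum_powerset_insert hn, pathSum, pathSum,
    ← sum_add_distrib, ← sum_add_distrib, mul_sum]
  refine sum_congr rfl fun X hX => ?_
  have hnX : n + 1 ∉ X := fun h => hn (mem_powerset.1 hX h)
  have hn' : n + 1 ∉ range (n + 1) \ X := fun h => hn (mem_sdiff.1 h).1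
  rw [insert_sdiff_of_notMem _ hnX, prod_insert hn']
  by_cases h1 : Sparse X <;> by_cases h2 : decide (0 ∈ X) = x <;> by_cases h3 : n ∈ X <;>
    simp [h1, h2, h3, hnX] <;> ring

/-- Position-dependent weights of chosen edges. Modulo `q + 1`, where `q = -1`, they are
`1, -2, 1, -2, …, 1` at the positions `0, …, 4 r` and `1` from there on. -/
def chosenWeight (r q i : ℕ) : ℕ := if i < 4 * r + 1 ∧ i % 2 = 1 then 2 * q else 1

/-- Position-dependent weights of edges that are not chosen. Modulo `q + 1`, where `q = -1`,
they are `1` at the positions `0, …, 4 r` and `-1` from there on. -/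
def unchosenWeight (r q i : ℕ) : ℕ := if i < 4 * r + 1 then 1 else q

end Path

section Weights
variable {R : Type*} [CommRing R]

/-- Adding an edge to a path multiplies the vector of the two path sums by a matrix. The product
of these matrices over four edges with the weights `-2, 1, -2, 1` of chosen edges is twice the
identity. -/
theorem pathSum_four_mul (r q : ℕ) (hq : (q : R) = -1) (j : ℕ) (hj : j ≤ r) (x y : Bool) :
    pathSum (fun i => (chosenWeight r q i : R)) (fun i => (unchosenWeight r q i : R)) (4 * j) x y =
      if x = y then 2 ^ j else 0 := by
  induction j generalizing y with
  | zero =>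
    rw [Nat.mul_zero, pathSum_zero]
    cases x <;> cases y <;> simp [chosenWeight, unchosenWeight]
  | succ j ih =>
    have ih := fun y => ih (by omega) y
    have c1 : chosenWeight r q (4 * j + 1) = 2 * q := if_pos (by omega)
    have c2 : chosenWeight r q (4 * j + 1 + 1) = 1 := if_neg (by omega)
    have c3 : chosenWeight r q (4 * j + 1 + 1 + 1) = 2 * q := if_pos (by omega)
    have c4 : chosenWeight r q (4 * j + 1 + 1 + 1 + 1) = 1 := if_neg (by omega)
    have u1 : unchosenWeight r q (4 * j + 1) = 1 := if_pos (by omega)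
    have u2 : unchosenWeight r q (4 * j + 1 + 1) = 1 := if_pos (by omega)
    have u3 : unchosenWeight r q (4 * j + 1 + 1 + 1) = 1 := if_pos (by omega)
    have u4 : unchosenWeight r q (4 * j + 1 + 1 + 1 + 1) = 1 := if_pos (by omega)
    rw [show 4 * (j + 1) = 4 * j + 1 + 1 + 1 + 1 by ring]
    cases x <;> cases y <;>
      simp only [pathSum_succ_true, pathSum_succ_false, ih, c1, c2, c3, c4, u1, u2, u3, u4] <;>
      push_cast <;> rw [hq] <;> ring

/-- The product of the matrices of three further edges, with weights `1` and `-1`, is the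
identity. -/
theorem pathSum_add_three_mul (r q : ℕ) (hq : (q : R) = -1) (k : ℕ) (x y : Bool) :
    pathSum (fun i => (chosenWeight r q i : R)) (fun i => (unchosenWeight r q i : R))
      (4 * r + 3 * k) x y = if x = y then 2 ^ r else 0 := by
  induction k generalizing y with
  | zero => exact pathSum_four_mul r q hq r le_rfl x y
  | succ k ih =>
    have c : ∀ i, 4 * r + 1 ≤ i → chosenWeight r q i = 1 := fun i hi => if_neg (by omega)
    have u : ∀ i, 4 * r + 1 ≤ i → unchosenWeight r q i = q := fun i hi => if_neg (by omega)
    have h1 : 4 * r + 1 ≤ 4 * r + 3 * k + 1 := by omega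
    rw [show 4 * r + 3 * (k + 1) = 4 * r + 3 * k + 1 + 1 + 1 by ring]
    cases x <;> cases y <;>
      simp only [pathSum_succ_true, pathSum_succ_false, ih, c _ h1, u _ h1,
        c _ (h1.trans (Nat.le_succ _)), u _ (h1.trans (Nat.le_succ _)),
        c _ (h1.trans (Nat.le_add_right _ 2)), u _ (h1.trans (Nat.le_add_right _ 2))] <;>
      push_cast <;> rw [hq] <;> ring

/-- For a path with at least seven edges, suitable weights modulo `q + 1` make the path sums
vanish if only one of the end edges is used, and equal a power of two otherwise. -/
theorem pathSum_eq_ite (n q : ℕ) (hn : 6 ≤ n) (hq : (q : R) = -1) (x y : Bool) :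
    pathSum (fun i => (chosenWeight (n % 3) q i : R)) (fun i => (unchosenWeight (n % 3) q i : R))
      n x y = if x = y then 2 ^ (n % 3) else 0 := by
  have h := pathSum_add_three_mul (R := R) (n % 3) q hq ((n - 4 * (n % 3)) / 3) x y
  have h' : 4 * (n % 3) + 3 * ((n - 4 * (n % 3)) / 3) = n := by omega
  rwa [h'] at h

end Weights

/-! ### The edges of a subdivision -/

namespace FinGraph

theorem inf_lt_sup (G : FinGraph) {e : Sym2 ℕ} (he : e ∈ G.E) : e.inf < e.sup := by
  have hl := G.loopless e he
  induction e with
  | _ x y =>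
    have hxy : x ≠ y := by simpa using hl
    rw [Sym2.inf_mk, Sym2.sup_mk]
    exact _root_.inf_lt_sup.2 hxy

theorem mem_iff_inf_sup (e : Sym2 ℕ) (v : ℕ) : v ∈ e ↔ v = e.inf ∨ v = e.sup := by
  induction e with
  | _ x y =>
    rw [Sym2.inf_mk, Sym2.sup_mk, Sym2.mem_iff]
    rcases le_total x y with h | h <;> simp [h, or_comm]

theorem lt_freshBase_of_mem (G : FinGraph) {e : Sym2 ℕ} (he : e ∈ G.E) {v : ℕ} (hv : v ∈ e) :
    v < G.freshBase :=
  G.lt_freshBase (G.mem_V e he v hv)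

theorem pathVertex_zero (G : FinGraph) (K : ℕ) (e : Sym2 ℕ) : G.pathVertex K e 0 = e.inf := by
  simp [pathVertex]

theorem pathVertex_self (G : FinGraph) {K : ℕ} (hK : 0 < K) (e : Sym2 ℕ) :
    G.pathVertex K e K = e.sup := by
  simp [pathVertex, hK.ne']

theorem pathVertex_inner (G : FinGraph) {K i : ℕ} (hi : 0 < i) (hiK : i < K) (e : Sym2 ℕ) :
    G.pathVertex K e i = G.freshBase + Nat.pair (Nat.pair e.inf e.sup) i := by
  simp [pathVertex, hi.ne', hiK]

/-- An inner vertex of a subdivided edge lies on no other subdivided edge, and occurs there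
only once. -/
theorem eq_of_pathVertex_eq (G : FinGraph) {K i j : ℕ} (hi : 0 < i) (hiK : i < K)
    {e f : Sym2 ℕ} (hf : f ∈ G.E) (h : G.pathVertex K e i = G.pathVertex K f j) :
    e = f ∧ i = j := by
  rw [G.pathVertex_inner hi hiK] at h
  have h1 := G.lt_freshBase_of_mem hf ((mem_iff_inf_sup f _).2 (.inl rfl))
  have h2 := G.lt_freshBase_of_mem hf ((mem_iff_inf_sup f _).2 (.inr rfl))
  unfold pathVertex at h
  split_ifs at h with h3 h4
  · omega
  · have h5 := Nat.pair_eq_pair.1 (Nat.add_left_cancel h)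
    exact ⟨Sym2.inf_eq_inf_and_sup_eq_sup.1 (Nat.pair_eq_pair.1 h5.1), h5.2⟩
  · omega

/-- The `i`-th edge of the path that replaces `e`. -/
def pathEdge (G : FinGraph) (K : ℕ) (e : Sym2 ℕ) (i : ℕ) : Sym2 ℕ :=
  s(G.pathVertex K e i, G.pathVertex K e (i + 1))

theorem mem_sub_E (G : FinGraph) (K : ℕ) (f : Sym2 ℕ) :
    f ∈ (G.sub K).E ↔ ∃ e ∈ G.E, ∃ i < K, G.pathEdge K e i = f := by
  simp [sub, pathEdge]

/-- A vertex common to two edges of the subdivision is an inner vertex of the same path, or an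
original vertex at which both edges end. -/
theorem common_vertex (G : FinGraph) {K : ℕ} {e f : Sym2 ℕ} {i j v : ℕ}
    (he : e ∈ G.E) (hf : f ∈ G.E) (hi : i < K) (hj : j < K)
    (hv : v ∈ G.pathEdge K e i) (hv' : v ∈ G.pathEdge K f j) :
    (e = f ∧ (i = j ∨ i = j + 1 ∨ j = i + 1)) ∨
      ((v = e.inf ∧ i = 0 ∨ v = e.sup ∧ i + 1 = K) ∧
        (v = f.inf ∧ j = 0 ∨ v = f.sup ∧ j + 1 = K)) := by
  obtain ⟨k, hk, rfl⟩ : ∃ k, (k = i ∨ k = i + 1) ∧ v = G.pathVertex K e k := by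
    rcases Sym2.mem_iff.1 hv with h | h
    exacts [⟨i, .inl rfl, h⟩, ⟨i + 1, .inr rfl, h⟩]
  obtain ⟨l, hl, h⟩ : ∃ l, (l = j ∨ l = j + 1) ∧ G.pathVertex K e k = G.pathVertex K f l := by
    rcases Sym2.mem_iff.1 hv' with h | h
    exacts [⟨j, .inl rfl, h⟩, ⟨j + 1, .inr rfl, h⟩]
  by_cases hk' : 0 < k ∧ k < K
  · obtain ⟨rfl, rfl⟩ := G.eq_of_pathVertex_eq hk'.1 hk'.2 hf h
    left
    exact ⟨rfl, by omega⟩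
  by_cases hl' : 0 < l ∧ l < K
  · obtain ⟨rfl, rfl⟩ := G.eq_of_pathVertex_eq hl'.1 hl'.2 he h.symm
    left
    exact ⟨rfl, by omega⟩
  right
  constructor
  · rcases Nat.eq_zero_or_pos k with rfl | hk0
    · exact .inl ⟨G.pathVertex_zero K e, by omega⟩
    · obtain rfl : k = K := by omega
      exact .inr ⟨G.pathVertex_self hk0 e, by omega⟩
  · rw [h]
    rcases Nat.eq_zero_or_pos l with rfl | hl0
    · exact .inl ⟨G.pathVertex_zero K f, by omega⟩
    · obtain rfl : l = K := by omega
      exact .inr ⟨G.pathVertex_self hl0 f, by omega⟩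

theorem pathEdge_injective (G : FinGraph) {K : ℕ} (hK : 2 ≤ K) {e f : Sym2 ℕ} {i j : ℕ}
    (he : e ∈ G.E) (hf : f ∈ G.E) (hi : i < K) (hj : j < K)
    (h : G.pathEdge K e i = G.pathEdge K f j) : e = f ∧ i = j := by
  -- One of the two ends of each path edge is an inner vertex.
  have key : ∀ {e f : Sym2 ℕ} {i j : ℕ}, e ∈ G.E → f ∈ G.E → i < K → j < K →
      G.pathEdge K e i = G.pathEdge K f j → e = f ∧ (i = j ∨ i = j + 1 ∨ j = i + 1) := by
    intro e f i j he hf hi hj h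
    have hm : ∀ k, (k = i ∨ k = i + 1) → G.pathVertex K e k ∈ G.pathEdge K f j := by
      rintro k (rfl | rfl) <;> rw [← h] <;> simp [pathEdge]
    obtain ⟨k, hk, hk0, hkK⟩ : ∃ k, (k = i ∨ k = i + 1) ∧ 0 < k ∧ k < K := by
      rcases Nat.eq_zero_or_pos i with rfl | h0
      · exact ⟨1, .inr rfl, by omega, by omega⟩
      · exact ⟨i, .inl rfl, h0, hi⟩
    rcases Sym2.mem_iff.1 (hm k hk) with h' | h' <;>
      obtain ⟨rfl, rfl⟩ := G.eq_of_pathVertex_eq hk0 hkK hf h' <;> exact ⟨rfl, by omega⟩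
  obtain ⟨rfl, hij⟩ := key he hf hi hj h
  refine ⟨rfl, ?_⟩
  have hlt := G.inf_lt_sup he
  have step : ∀ i, i + 1 < K → G.pathEdge K e i ≠ G.pathEdge K e (i + 1) := by
    intro i hi h
    rw [pathEdge, pathEdge, Sym2.eq_iff] at h
    rcases h with ⟨-, h⟩ | ⟨h, -⟩
    · exact absurd (G.eq_of_pathVertex_eq (by omega) hi he h).2 (by omega)
    · rcases Nat.eq_zero_or_pos i with rfl | h0
      · rcases Nat.lt_or_ge 2 K with h2 | h2
        · exact absurd (G.eq_of_pathVertex_eq (by omega) h2 he h.symm).2 (by omega)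
        · obtain rfl : K = 2 := by omega
          rw [G.pathVertex_zero, G.pathVertex_self (by omega)] at h
          omega
      · exact absurd (G.eq_of_pathVertex_eq h0 (by omega) he h).2 (by omega)
  rcases hij with rfl | rfl | rfl
  · rfl
  · exact absurd h.symm (step _ hi)
  · exact absurd h (step _ hj)

/-! ### Weighted matchings of a subdivision -/

section Weighted
variable {R : Type*} [CommSemiring R]

/-- The total weight of the matchings of `G`, where an edge `e` contributes the factor `a e` if
it is chosen and `b e` otherwise. -/
noncomputable def weightSum (G : FinGraph) (a b : Sym2 ℕ → R) : R :=
  ∑ M ∈ G.matchings, (∏ e ∈ M, a e) * ∏ e ∈ G.E \ M, b e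

/-- The set of edges of the subdivision with positions `F e` on the path that replaces `e`. -/
def pathEdges (G : FinGraph) (K : ℕ) (F : G.E → Finset ℕ) : Finset (Sym2 ℕ) :=
  univ.biUnion fun e => (F e).image (G.pathEdge K e)

theorem mem_pathEdges (G : FinGraph) {K : ℕ} {F : G.E → Finset ℕ} {f : Sym2 ℕ} :
    f ∈ G.pathEdges K F ↔ ∃ e : G.E, ∃ i ∈ F e, G.pathEdge K e i = f := by
  simp [pathEdges]

theorem pathEdge_mem_pathEdges (G : FinGraph) {K : ℕ} (hK : 2 ≤ K) {F : G.E → Finset ℕ}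
    (hF : ∀ e, F e ⊆ range K) {e : G.E} {i : ℕ} (hi : i < K) :
    G.pathEdge K e i ∈ G.pathEdges K F ↔ i ∈ F e := by
  rw [mem_pathEdges]
  constructor
  · rintro ⟨f, j, hj, h⟩
    obtain ⟨h1, rfl⟩ := G.pathEdge_injective hK f.2 e.2 (mem_range.1 (hF f hj)) hi h
    obtain rfl := Subtype.ext h1
    exact hj
  · exact fun h => ⟨e, i, h, rfl⟩

theorem prod_pathEdges (G : FinGraph) {K : ℕ} (hK : 2 ≤ K) {F : G.E → Finset ℕ}
    (hF : ∀ e, F e ⊆ range K) (a : Sym2 ℕ → R) :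
    ∏ f ∈ G.pathEdges K F, a f = ∏ e : G.E, ∏ i ∈ F e, a (G.pathEdge K e i) := by
  rw [pathEdges, prod_biUnion]
  · refine prod_congr rfl fun e _ => prod_image fun i hi j hj h => ?_
    exact (G.pathEdge_injective hK e.2 e.2 (mem_range.1 (hF e hi)) (mem_range.1 (hF e hj)) h).2
  · intro e _ f _ hne
    refine disjoint_left.2 fun g hg hg' => hne ?_
    obtain ⟨i, hi, rfl⟩ := mem_image.1 hg
    obtain ⟨j, hj, h⟩ := mem_image.1 hg'
    exact Subtype.ext (G.pathEdge_injective hK f.2 e.2 (mem_range.1 (hF f hj))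
      (mem_range.1 (hF e hi)) h).1.symm

theorem sub_E_eq_pathEdges (G : FinGraph) (K : ℕ) :
    (G.sub K).E = G.pathEdges K fun _ => range K := by
  ext f
  simp [mem_sub_E, mem_pathEdges]

theorem sub_E_sdiff_pathEdges (G : FinGraph) {K : ℕ} (hK : 2 ≤ K) {F : G.E → Finset ℕ}
    (hF : ∀ e, F e ⊆ range K) :
    (G.sub K).E \ G.pathEdges K F = G.pathEdges K fun e => range K \ F e := by
  ext f
  rw [mem_sdiff, sub_E_eq_pathEdges, mem_pathEdges, mem_pathEdges (F := fun e => range K \ F e)]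
  constructor
  · rintro ⟨⟨e, i, hi, rfl⟩, h⟩
    rw [G.pathEdge_mem_pathEdges hK hF (mem_range.1 hi)] at h
    exact ⟨e, i, mem_sdiff.2 ⟨hi, h⟩, rfl⟩
  · rintro ⟨e, i, hi, rfl⟩
    obtain ⟨hi, h⟩ := mem_sdiff.1 hi
    rw [G.pathEdge_mem_pathEdges hK hF (mem_range.1 hi)]
    exact ⟨⟨e, i, hi, rfl⟩, h⟩

/-- Sums over the edge sets of a subdivision are sums over all choices of positions on the
paths. -/
theorem sum_powerset_sub (G : FinGraph) {K : ℕ} (hK : 2 ≤ K) (h : Finset (Sym2 ℕ) → R) :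
    ∑ M ∈ (G.sub K).E.powerset, h M =
      ∑ F ∈ Fintype.piFinset fun _ : G.E => (range K).powerset, h (G.pathEdges K F) := by
  classical
  symm
  have hsub : ∀ F ∈ Fintype.piFinset (fun _ : G.E => (range K).powerset), ∀ e, F e ⊆ range K :=
    fun F hF e => mem_powerset.1 (Fintype.mem_piFinset.1 hF e)
  refine sum_bij' (fun F _ => G.pathEdges K F)
    (fun M _ e => (range K).filter fun i => G.pathEdge K e i ∈ M) ?_ ?_ ?_ ?_ ?_
  · intro F hF
    refine mem_powerset.2 fun f hf => ?_
    obtain ⟨e, i, hi, rfl⟩ := (mem_pathEdges _).1 hf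
    exact (mem_sub_E _ _ _).2 ⟨e, e.2, i, mem_range.1 (hsub F hF e hi), rfl⟩
  · intro M _
    exact Fintype.mem_piFinset.2 fun e => mem_powerset.2 (filter_subset _ _)
  · intro F hF
    funext e
    ext i
    rw [mem_filter]
    constructor
    · rintro ⟨hi, h⟩
      exact (G.pathEdge_mem_pathEdges hK (hsub F hF) (mem_range.1 hi)).1 h
    · intro hi
      have hi' := hsub F hF e hi
      exact ⟨hi', (G.pathEdge_mem_pathEdges hK (hsub F hF) (mem_range.1 hi')).2 hi⟩
  · intro M hM
    ext f
    rw [mem_pathEdges]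
    constructor
    · rintro ⟨e, i, hi, rfl⟩
      exact (mem_filter.1 hi).2
    · intro hf
      obtain ⟨e, he, i, hi, rfl⟩ := (mem_sub_E _ _ _).1 (mem_powerset.1 hM hf)
      exact ⟨⟨e, he⟩, i, mem_filter.2 ⟨mem_range.2 hi, hf⟩, rfl⟩
  · intro F _
    rfl

/-- For `σ` telling which ends of which paths carry a chosen edge: `v` is such an end of `e`. -/
def EndUsed (G : FinGraph) (σ : G.E → Bool × Bool) (e : G.E) (v : ℕ) : Prop :=
  v = e.1.inf ∧ (σ e).1 = true ∨ v = e.1.sup ∧ (σ e).2 = true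

/-- No two chosen edges on different paths share an end. -/
def EndsDisjoint (G : FinGraph) (σ : G.E → Bool × Bool) : Prop :=
  ∀ e f : G.E, e ≠ f → ∀ v, G.EndUsed σ e v → ¬ G.EndUsed σ f v

/-- For a choice of positions on the paths of length `n + 1`: which ends carry a chosen edge. -/
def ends (G : FinGraph) (n : ℕ) (F : G.E → Finset ℕ) (e : G.E) : Bool × Bool :=
  (decide (0 ∈ F e), decide (n ∈ F e))

theorem pairwiseDisjointEdges_pathEdges_iff (G : FinGraph) {n : ℕ} (hn : 1 ≤ n)
    {F : G.E → Finset ℕ} (hF : ∀ e, F e ⊆ range (n + 1)) :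
    PairwiseDisjointEdges (G.pathEdges (n + 1) F) ↔
      (∀ e, Sparse (F e)) ∧ G.EndsDisjoint (G.ends n F) := by
  have hlt : ∀ e, ∀ i ∈ F e, i < n + 1 := fun e i hi => mem_range.1 (hF e hi)
  have used : ∀ e v, G.EndUsed (G.ends n F) e v →
      ∃ i ∈ F e, v ∈ G.pathEdge (n + 1) e i := by
    rintro e v (⟨rfl, h⟩ | ⟨rfl, h⟩)
    · exact ⟨0, by simpa [ends] using h, by simp [pathEdge, pathVertex_zero]⟩
    · exact ⟨n, by simpa [ends] using h, by simp [pathEdge, pathVertex_self]⟩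
  constructor
  · intro h
    refine ⟨fun e i hi hi' => ?_, fun e f hne v hv hv' => ?_⟩
    · refine h _ ((mem_pathEdges _).2 ⟨e, i, hi, rfl⟩) _ ((mem_pathEdges _).2 ⟨e, i + 1, hi', rfl⟩)
        (fun h' => ?_) (G.pathVertex (n + 1) e (i + 1)) (by simp [pathEdge]) (by simp [pathEdge])
      have := (G.pathEdge_injective (by omega) e.2 e.2 (hlt e _ hi) (hlt e _ hi') h').2
      omega
    · obtain ⟨i, hi, hvi⟩ := used e v hv
      obtain ⟨j, hj, hvj⟩ := used f v hv'
      refine h _ ((mem_pathEdges _).2 ⟨e, i, hi, rfl⟩) _ ((mem_pathEdges _).2 ⟨f, j, hj, rfl⟩)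
        (fun h' => hne ?_) v hvi hvj
      exact Subtype.ext
        (G.pathEdge_injective (by omega) e.2 f.2 (hlt e _ hi) (hlt f _ hj) h').1
  · rintro ⟨hs, hd⟩ x hx y hy hne v hvx hvy
    obtain ⟨e, i, hi, rfl⟩ := (mem_pathEdges _).1 hx
    obtain ⟨f, j, hj, rfl⟩ := (mem_pathEdges _).1 hy
    rcases G.common_vertex e.2 f.2 (hlt e i hi) (hlt f j hj) hvx hvy with ⟨h, hij⟩ | ⟨h1, h2⟩
    · obtain rfl := Subtype.ext h
      rcases hij with rfl | rfl | rfl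
      · exact hne rfl
      · exact hs e j hj hi
      · exact hs e i hi hj
    · by_cases hef : e = f
      · subst hef
        have := G.inf_lt_sup e.2
        rcases h1 with ⟨h1, h1'⟩ | ⟨h1, h1'⟩ <;> rcases h2 with ⟨h2, h2'⟩ | ⟨h2, h2'⟩
        · exact hne (by rw [h1', h2'])
        · omega
        · omega
        · obtain rfl : i = j := by omega
          exact hne rfl
      · have toUsed : ∀ (e : G.E) (i : ℕ), i ∈ F e →
            (v = e.1.inf ∧ i = 0 ∨ v = e.1.sup ∧ i + 1 = n + 1) →
            G.EndUsed (G.ends n F) e v := by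
          rintro e i hi (⟨h, rfl⟩ | ⟨h, h'⟩)
          · exact .inl ⟨h, by simpa [ends] using hi⟩
          · obtain rfl : i = n := by omega
            exact .inr ⟨h, by simpa [ends] using hi⟩
        exact hd e f hef v (toUsed e i hi h1) (toUsed f j hj h2)

open Classical in
/-- The weighted matchings of a subdivision, sorted by the ends of the paths that carry a chosen
edge. -/
theorem weightSum_sub (G : FinGraph) {n : ℕ} (hn : 1 ≤ n) (a b : Sym2 ℕ → R) (α β : ℕ → R)
    (ha : ∀ e ∈ G.E, ∀ i < n + 1, a (G.pathEdge (n + 1) e i) = α i)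
    (hb : ∀ e ∈ G.E, ∀ i < n + 1, b (G.pathEdge (n + 1) e i) = β i) :
    (G.sub (n + 1)).weightSum a b =
      ∑ σ : G.E → Bool × Bool, if G.EndsDisjoint σ then
        ∏ e, pathSum α β n (σ e).1 (σ e).2 else 0 := by
  have hK : 2 ≤ n + 1 := by omega
  have hsub : ∀ F ∈ Fintype.piFinset (fun _ : G.E => (range (n + 1)).powerset),
      ∀ e, F e ⊆ range (n + 1) :=
    fun F hF e => mem_powerset.1 (Fintype.mem_piFinset.1 hF e)
  rw [weightSum, matchings, sum_filter, G.sum_powerset_sub hK, ← sum_fiberwise _ (G.ends n)]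
  refine sum_congr rfl fun σ _ => ?_
  have hprod : ∀ e : G.E, pathSum α β n (σ e).1 (σ e).2 =
      ∑ X ∈ (range (n + 1)).powerset,
        if Sparse X ∧ decide (0 ∈ X) = (σ e).1 ∧ decide (n ∈ X) = (σ e).2 then
          (∏ i ∈ X, α i) * ∏ i ∈ range (n + 1) \ X, β i else 0 := fun e => rfl
  simp_rw [hprod]
  rw [prod_univ_sum, sum_filter, ← mul_boole, sum_mul]
  refine sum_congr rfl fun F hF => ?_
  have hF := hsub F hF
  have hσ : G.ends n F = σ ↔ ∀ e, decide (0 ∈ F e) = (σ e).1 ∧ decide (n ∈ F e) = (σ e).2 := by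
    simp only [funext_iff, ends, Prod.ext_iff]
  rw [prod_ite_zero]
  by_cases h1 : G.ends n F = σ
  · have h1' := hσ.1 h1
    rw [if_pos h1]
    simp only [mem_univ, true_imp_iff, h1', and_self, and_true,
      G.pairwiseDisjointEdges_pathEdges_iff hn hF, h1]
    by_cases h2 : G.EndsDisjoint σ
    · simp only [h2, and_true, if_true, mul_one]
      congr 1
      rw [G.sub_E_sdiff_pathEdges hK hF, G.prod_pathEdges hK hF, G.prod_pathEdges hK
        (fun e => sdiff_subset), ← prod_mul_distrib]
      refine prod_congr rfl fun e _ => ?_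
      congr 1
      · exact prod_congr rfl fun i hi => ha e e.2 i (mem_range.1 (hF e hi))
      · exact prod_congr rfl fun i hi => hb e e.2 i (mem_range.1 (sdiff_subset hi))
    · simp [h2]
  · rw [if_neg h1, if_neg fun h => h1 (hσ.2 fun e => (h e (mem_univ e)).2), zero_mul]

/-- If the path sums vanish unless both or none of the two end edges are used, then the weighted
matchings of the subdivision correspond to matchings of the original graph. -/
theorem weightSum_sub_eq (G : FinGraph) {n : ℕ} (hn : 1 ≤ n) (a b : Sym2 ℕ → R) (α β : ℕ → R)
    (ha : ∀ e ∈ G.E, ∀ i < n + 1, a (G.pathEdge (n + 1) e i) = α i)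
    (hb : ∀ e ∈ G.E, ∀ i < n + 1, b (G.pathEdge (n + 1) e i) = β i)
    (c : R) (hc : ∀ x y, pathSum α β n x y = if x = y then c else 0) :
    (G.sub (n + 1)).weightSum a b = c ^ G.E.card * G.numMatchings := by
  classical
  rw [G.weightSum_sub hn a b α β ha hb, numMatchings]
  simp only [hc, prod_ite_zero, mem_univ, true_imp_iff, prod_const, card_univ,
    Fintype.card_coe, ← ite_and]
  rw [← sum_filter, sum_const, nsmul_eq_mul, mul_comm]
  congr 2
  symm
  -- A matching corresponds to the paths both of whose end edges are chosen.
  refine card_bij' (fun M _ e => (decide (e.1 ∈ M), decide (e.1 ∈ M)))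
    (fun σ _ => G.E.filter fun e => ∃ h : e ∈ G.E, (σ ⟨e, h⟩).1 = true) ?_ ?_ ?_ ?_
  · intro M hM
    obtain ⟨hM, hd⟩ := mem_filter.1 hM
    refine mem_filter.2 ⟨mem_univ _, fun e f hne v hv hv' => ?_, fun e => rfl⟩
    have hm : ∀ e : G.E, G.EndUsed (fun e => (decide (e.1 ∈ M), decide (e.1 ∈ M))) e v →
        e.1 ∈ M ∧ v ∈ e.1 := by
      rintro e (⟨h, h'⟩ | ⟨h, h'⟩)
      · exact ⟨by simpa using h', (mem_iff_inf_sup _ _).2 (.inl h)⟩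
      · exact ⟨by simpa using h', (mem_iff_inf_sup _ _).2 (.inr h)⟩
    exact hd e (hm e hv).1 f (hm f hv').1 (fun h => hne (Subtype.ext h)) v (hm e hv).2 (hm f hv').2
  · intro σ hσ
    obtain ⟨-, hd, hσ⟩ := mem_filter.1 hσ
    refine mem_filter.2 ⟨mem_powerset.2 (filter_subset _ _), fun e he f hf hne v hv hv' => ?_⟩
    obtain ⟨-, he, hσe⟩ := mem_filter.1 he
    obtain ⟨-, hf, hσf⟩ := mem_filter.1 hf
    have hu : ∀ e : G.E, (σ e).1 = true → v ∈ e.1 → G.EndUsed σ e v := fun e h hv =>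
      ((mem_iff_inf_sup _ _).1 hv).imp (fun hv => ⟨hv, h⟩) (fun hv => ⟨hv, hσ e ▸ h⟩)
    exact hd ⟨e, he⟩ ⟨f, hf⟩ (fun h => hne (congrArg Subtype.val h)) v (hu _ hσe hv) (hu _ hσf hv')
  · intro M hM
    have hM := mem_powerset.1 (mem_filter.1 hM).1
    ext e
    simp only [mem_filter, decide_eq_true_eq, exists_prop]
    exact ⟨fun h => h.2.2, fun h => ⟨hM h, hM h, h⟩⟩
  · intro σ hσ
    obtain ⟨-, -, hσ⟩ := mem_filter.1 hσ
    funext e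
    have : decide (e.1 ∈ G.E.filter fun e => ∃ h : e ∈ G.E, (σ ⟨e, h⟩).1 = true) = (σ e).1 := by
      simp [Bool.decide_eq_true]
    exact Prod.ext this (this.trans (hσ e))

theorem weightSum_mul (G : FinGraph) (a b c : Sym2 ℕ → R) :
    G.weightSum (fun e => c e * a e) (fun e => c e * b e) = (∏ e ∈ G.E, c e) * G.weightSum a b := by
  rw [weightSum, weightSum, mul_sum]
  refine sum_congr rfl fun M hM => ?_
  classical
  have hM : M ⊆ G.E := mem_powerset.1 (mem_filter.1 hM).1
  rw [prod_mul_distrib, prod_mul_distrib, ← prod_sdiff hM]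
  ring

end Weighted

theorem numMatchings_le (G : FinGraph) : G.numMatchings ≤ 2 ^ G.E.card := by
  classical
  rw [← card_powerset]
  exact card_le_card (filter_subset _ _)

end FinGraph

/-! ### Recovering the number of matchings from one probability -/

namespace FinGraph

open Classical in
/-- The position of an edge of the subdivision on its path; `0` for all other pairs. -/
noncomputable def position (G : FinGraph) (K : ℕ) (f : Sym2 ℕ) : ℕ :=
  if h : ∃ i < K, ∃ e ∈ G.E, G.pathEdge K e i = f then h.choose else 0

theorem position_pathEdge (G : FinGraph) {K : ℕ} (hK : 2 ≤ K) {e : Sym2 ℕ} (he : e ∈ G.E) {i : ℕ}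
    (hi : i < K) : G.position K (G.pathEdge K e i) = i := by
  have h : ∃ j < K, ∃ f ∈ G.E, G.pathEdge K f j = G.pathEdge K e i := ⟨i, hi, e, he, rfl⟩
  rw [position, dif_pos h]
  obtain ⟨h1, f, hf, h2⟩ := h.choose_spec
  exact (G.pathEdge_injective hK hf he h1 hi h2).2

/-- The edge probabilities on the subdivision that make the chosen and unchosen weights of each
edge proportional to the given ones. -/
noncomputable def pathProb (G : FinGraph) (K r q : ℕ) (f : Sym2 ℕ) : ℚ :=
  (chosenWeight r q (G.position K f) : ℚ) /
    ((chosenWeight r q (G.position K f) + unchosenWeight r q (G.position K f) : ℕ) : ℚ)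

end FinGraph

/-- The common denominator of the probabilities on a path of length `K`. -/
def pathDenom (K r q : ℕ) : ℕ := ∏ i ∈ range K, (chosenWeight r q i + unchosenWeight r q i)

theorem chosenWeight_pos (r i : ℕ) {q : ℕ} (hq : 0 < q) : 0 < chosenWeight r q i := by
  unfold chosenWeight; split_ifs <;> omega

theorem pathDenom_pos (K r : ℕ) {q : ℕ} (hq : 0 < q) : 0 < pathDenom K r q :=
  prod_pos fun i _ => Nat.add_pos_left (chosenWeight_pos r i hq) _

namespace FinGraph

theorem pathProb_nonneg (G : FinGraph) (K r q : ℕ) (f : Sym2 ℕ) : 0 ≤ G.pathProb K r q f := by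
  unfold pathProb; positivity

theorem pathProb_le_one (G : FinGraph) (K r q : ℕ) (f : Sym2 ℕ) : G.pathProb K r q f ≤ 1 := by
  unfold pathProb
  refine div_le_one_of_le₀ ?_ (by positivity)
  exact_mod_cast Nat.le_add_right _ _

/-- The integral weighted count of matchings of the subdivision. -/
noncomputable def pathWeight (G : FinGraph) (K r q : ℕ) : ℕ :=
  (G.sub K).weightSum (fun f => chosenWeight r q (G.position K f))
    (fun f => unchosenWeight r q (G.position K f))

theorem prod_sub_denom (G : FinGraph) {K : ℕ} (hK : 2 ≤ K) (r q : ℕ) :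
    ∏ f ∈ (G.sub K).E, (chosenWeight r q (G.position K f) + unchosenWeight r q (G.position K f)) =
      pathDenom K r q ^ G.E.card := by
  rw [sub_E_eq_pathEdges, G.prod_pathEdges hK fun _ => Subset.rfl,
    prod_congr rfl fun e _ => prod_congr rfl fun i hi => by
      rw [G.position_pathEdge hK e.2 (mem_range.1 hi)]]
  simp [pathDenom]

theorem pathWeight_eq_mul_prMatching (G : FinGraph) {K : ℕ} (hK : 2 ≤ K) (r : ℕ) {q : ℕ}
    (hq : 0 < q) :
    (G.pathWeight K r q : ℚ) =
      (pathDenom K r q : ℚ) ^ G.E.card * (G.sub K).prMatching (G.pathProb K r q) := by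
  have h := (G.sub K).weightSum_mul (G.pathProb K r q) (fun f => 1 - G.pathProb K r q f)
    (fun f => ((chosenWeight r q (G.position K f) + unchosenWeight r q (G.position K f) : ℕ) : ℚ))
  have hne : ∀ f, ((chosenWeight r q (G.position K f) +
      unchosenWeight r q (G.position K f) : ℕ) : ℚ) ≠ 0 := fun f => by
    have := chosenWeight_pos r (G.position K f) hq
    exact_mod_cast (by omega)
  have h1 : (G.sub K).prMatching (G.pathProb K r q) =
      (G.sub K).weightSum (G.pathProb K r q) (fun f => 1 - G.pathProb K r q f) := rfl
  rw [← Nat.cast_prod, G.prod_sub_denom hK, ← h1] at h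
  rw [← Nat.cast_pow, ← h, pathWeight, weightSum, weightSum]
  push_cast
  refine sum_congr rfl fun M _ => ?_
  have e1 : ∀ f, ((chosenWeight r q (G.position K f) : ℚ) + unchosenWeight r q (G.position K f)) *
      G.pathProb K r q f = chosenWeight r q (G.position K f) := fun f => by
    have := hne f
    rw [pathProb]
    push_cast at this ⊢
    field_simp
  simp only [mul_sub, mul_one, e1, add_sub_cancel_left]

theorem pathWeight_le (G : FinGraph) {K : ℕ} (hK : 2 ≤ K) (r q : ℕ) :
    G.pathWeight K r q ≤ pathDenom K r q ^ G.E.card := by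
  classical
  rw [← G.prod_sub_denom hK, prod_add, pathWeight, weightSum]
  exact sum_le_sum_of_subset (filter_subset _ _)

/-- Modulo `q + 1`, the weighted count of matchings of the subdivision is a known multiple of the
number of matchings of the original graph. -/
theorem pathWeight_modEq (G : FinGraph) {K : ℕ} (hK : 7 ≤ K) (q : ℕ) :
    G.pathWeight K ((K - 1) % 3) q ≡
      (2 ^ ((K - 1) % 3)) ^ G.E.card * G.numMatchings [MOD q + 1] := by
  obtain ⟨n, rfl⟩ : ∃ n, K = n + 1 := ⟨K - 1, by omega⟩
  have hq : ((q : ℕ) : ZMod (q + 1)) = -1 := by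
    have := ZMod.natCast_self (q + 1)
    push_cast at this
    exact eq_neg_of_add_eq_zero_left this
  rw [← ZMod.natCast_eq_natCast_iff, Nat.add_sub_cancel]
  have h := G.weightSum_sub_eq (n := n) (by omega)
    (fun f => (chosenWeight (n % 3) q (G.position (n + 1) f) : ZMod (q + 1)))
    (fun f => (unchosenWeight (n % 3) q (G.position (n + 1) f) : ZMod (q + 1)))
    (fun i => (chosenWeight (n % 3) q i : ZMod (q + 1)))
    (fun i => (unchosenWeight (n % 3) q i : ZMod (q + 1)))
    (fun e he i hi => by rw [G.position_pathEdge (by omega) he hi])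
    (fun e he i hi => by rw [G.position_pathEdge (by omega) he hi])
    (2 ^ (n % 3)) (pathSum_eq_ite n q (by omega) hq)
  push_cast
  rw [← h, pathWeight, weightSum, weightSum]
  push_cast
  rfl

theorem prMatching_pathProb_nonneg (G : FinGraph) {K : ℕ} (hK : 2 ≤ K) (r : ℕ) {q : ℕ}
    (hq : 0 < q) :
    0 ≤ (G.sub K).prMatching (G.pathProb K r q) := by
  have h := G.pathWeight_eq_mul_prMatching hK r hq
  have hD : (0 : ℚ) < (pathDenom K r q : ℚ) ^ G.E.card :=
    pow_pos (by exact_mod_cast pathDenom_pos K r hq) _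
  by_contra hneg
  have h1 := mul_neg_of_pos_of_neg hD (not_le.1 hneg)
  rw [← h] at h1
  exact absurd h1 (not_lt.2 (Nat.cast_nonneg _))

/-- The probability times the common denominator of the edge probabilities is the integral weighted
count, stated without division. -/
theorem prMatching_num_mul (G : FinGraph) {K : ℕ} (hK : 2 ≤ K) (r : ℕ) {q : ℕ} (hq : 0 < q) :
    ((G.sub K).prMatching (G.pathProb K r q)).num.toNat * pathDenom K r q ^ G.E.card =
      G.pathWeight K r q * ((G.sub K).prMatching (G.pathProb K r q)).den := by
  have h := G.pathWeight_eq_mul_prMatching hK r hq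
  have hp := G.prMatching_pathProb_nonneg hK r hq
  set p := (G.sub K).prMatching (G.pathProb K r q)
  have hnum : ((p.num.toNat : ℤ) : ℚ) = p.num := by rw [Int.toNat_of_nonneg (Rat.num_nonneg.2 hp)]
  have hp' : p * p.den = p.num := Rat.mul_den_eq_num p
  have : ((p.num.toNat * pathDenom K r q ^ G.E.card : ℕ) : ℚ) =
      ((G.pathWeight K r q * p.den : ℕ) : ℚ) := by
    push_cast
    rw [h, ← Int.cast_natCast (R := ℚ) p.num.toNat, hnum, ← hp']
    ring
  exact_mod_cast this

theorem prMatching_den_le (G : FinGraph) {K : ℕ} (hK : 2 ≤ K) (r : ℕ) {q : ℕ} (hq : 0 < q) :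
    ((G.sub K).prMatching (G.pathProb K r q)).den ≤ pathDenom K r q ^ G.E.card := by
  have h := G.prMatching_num_mul hK r hq
  have hp := G.prMatching_pathProb_nonneg hK r hq
  set p := (G.sub K).prMatching (G.pathProb K r q)
  refine Nat.le_of_dvd (pow_pos (pathDenom_pos K r hq) _) ?_
  have hco : p.den.Coprime p.num.toNat := by
    have h1 : p.num.toNat = p.num.natAbs := by
      have := Rat.num_nonneg.2 hp
      omega
    exact h1 ▸ p.reduced.symm
  exact hco.dvd_of_dvd_mul_left ⟨_, h.trans (mul_comm _ _)⟩

theorem prMatching_num_le (G : FinGraph) {K : ℕ} (hK : 2 ≤ K) (r : ℕ) {q : ℕ} (hq : 0 < q) :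
    ((G.sub K).prMatching (G.pathProb K r q)).num.toNat ≤ pathDenom K r q ^ G.E.card := by
  have h := G.prMatching_num_mul hK r hq
  have h1 := G.prMatching_den_le hK r hq
  have h2 := G.pathWeight_le hK r q
  have h3 := pow_pos (pathDenom_pos K r hq) G.E.card
  refine Nat.le_of_mul_le_mul_right (h.trans_le ?_) h3
  exact Nat.mul_le_mul h2 h1

/-- The number of matchings is read off from the probability that a random edge set of the
subdivision is a matching. -/
theorem numMatchings_eq (G : FinGraph) {K : ℕ} (hK : 7 ≤ K) {q c : ℕ} (hc : c = 2 ^ ((K - 1) % 3))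
    (hq : q = (c * 2) ^ G.E.card) {p : ℚ}
    (hp : p = (G.sub K).prMatching (G.pathProb K ((K - 1) % 3) q)) :
    p.num.toNat * pathDenom K ((K - 1) % 3) q ^ G.E.card / p.den % (q + 1) / c ^ G.E.card =
      G.numMatchings := by
  have hc0 : 0 < c := hc ▸ pow_pos two_pos _
  have hq0 : 0 < q := hq ▸ pow_pos (by omega) _
  rw [hp, G.prMatching_num_mul (by omega) _ hq0, Nat.mul_div_cancel _ (Rat.den_pos _),
    G.pathWeight_modEq hK q, ← hc, Nat.mod_eq_of_lt, Nat.mul_div_cancel_left _ (pow_pos hc0 _)]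
  rw [Nat.lt_succ_iff, hq, mul_pow]
  exact Nat.mul_le_mul_left _ G.numMatchings_le

end FinGraph

/-! ### A weakest precondition calculus with resource bounds -/

instance : Add AExp := ⟨.op .add⟩
instance : Sub AExp := ⟨.op .sub⟩
instance : Mul AExp := ⟨.op .mul⟩
instance : Div AExp := ⟨.op .div⟩

namespace AExp

theorem eval_const (s : Mem) (n : ℕ) : (const n).eval s = n := rfl
theorem eval_reg (s : Mem) (x : ℕ) : (reg x).eval s = s.reg x := rfl
theorem eval_read (s : Mem) (a : ℕ) (i : AExp) : (read a i).eval s = s.arr a (i.eval s) := rfl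
theorem eval_add (s : Mem) (l r : AExp) : (l + r).eval s = l.eval s + r.eval s := rfl
theorem eval_sub (s : Mem) (l r : AExp) : (l - r).eval s = l.eval s - r.eval s := rfl
theorem eval_mul (s : Mem) (l r : AExp) : (l * r).eval s = l.eval s * r.eval s := rfl
theorem eval_div (s : Mem) (l r : AExp) : (l / r).eval s = l.eval s / r.eval s := rfl

/-- If all numbers in the memory have at most `B` bits, then the value of the expression has at
most `B + 1` times this many bits. -/
def sizeFactor : AExp → ℕ
  | .const n => n.size + 1
  | .reg _ => 1
  | .read _ _ => 1
  | .op _ l r => l.sizeFactor + r.sizeFactor + 1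

/-- If all numbers in the memory have at most `B` bits, then the cost of evaluating the
expression is at most `B + 1` times this number. -/
def costFactor : AExp → ℕ
  | .const n => n.size + 1
  | .reg _ => 1
  | .read _ i => i.costFactor + i.sizeFactor + 1
  | .op _ l r => l.costFactor + r.costFactor + l.sizeFactor + r.sizeFactor + 1

end AExp

/-- All numbers in the memory have at most `B` bits. -/
def Mem.Bounded (B : ℕ) (s : Mem) : Prop :=
  (∀ x, (s.reg x).size ≤ B) ∧ ∀ a i, (s.arr a i).size ≤ B

theorem BinOp.size_eval_le (o : BinOp) (a b : ℕ) : (o.eval a b).size ≤ a.size + b.size + 1 := by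
  rw [Nat.size_le]
  have ha := Nat.lt_size_self a
  have hb := Nat.lt_size_self b
  have ha' : 2 ^ a.size ≤ 2 ^ (a.size + b.size) :=
    Nat.pow_le_pow_right two_pos (Nat.le_add_right _ _)
  have hb' : 2 ^ b.size ≤ 2 ^ (a.size + b.size) :=
    Nat.pow_le_pow_right two_pos (Nat.le_add_left _ _)
  have h1 : 2 ^ (a.size + b.size + 1) = 2 ^ (a.size + b.size) * 2 := pow_succ _ _
  cases o with
  | add => simp only [eval]; omega
  | sub => simp only [eval]; omega
  | mul =>
    have := Nat.mul_lt_mul'' ha hb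
    rw [← pow_add] at this
    simp only [eval]; omega
  | div =>
    have := Nat.div_le_self a b
    simp only [eval]; omega

theorem AExp.size_eval_le {B : ℕ} {s : Mem} (hs : s.Bounded B) (e : AExp) :
    (e.eval s).size ≤ e.sizeFactor * (B + 1) := by
  induction e with
  | const n => simp only [eval, sizeFactor]; nlinarith
  | reg x => have := hs.1 x; simp only [eval, sizeFactor]; omega
  | read a i => have := hs.2 a (i.eval s); simp only [eval, sizeFactor]; omega
  | op o l r ihl ihr =>
    have := o.size_eval_le (l.eval s) (r.eval s)
    simp only [eval, sizeFactor]; nlinarith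

theorem AExp.cost_le {B : ℕ} {s : Mem} (hs : s.Bounded B) (e : AExp) :
    e.cost s ≤ e.costFactor * (B + 1) := by
  induction e with
  | const n => simp only [cost, costFactor]; nlinarith
  | reg x => have := hs.1 x; simp only [cost, costFactor]; omega
  | read a i ih =>
    have := hs.2 a (i.eval s)
    have := i.size_eval_le hs
    simp only [cost, costFactor]; nlinarith
  | op o l r ihl ihr =>
    have := l.size_eval_le hs
    have := r.size_eval_le hs
    simp only [cost, costFactor]; nlinarith

theorem Mem.Bounded.setReg {B : ℕ} {s : Mem} (hs : s.Bounded B) (x : ℕ) {v : ℕ} (hv : v.size ≤ B) :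
    (s.setReg x v).Bounded B := by
  refine ⟨fun y => ?_, hs.2⟩
  simp only [Mem.setReg, Function.update_apply]
  split_ifs
  exacts [hv, hs.1 y]

theorem Mem.Bounded.setEntry {B : ℕ} {s : Mem} (hs : s.Bounded B) (a i : ℕ) {v : ℕ}
    (hv : v.size ≤ B) : (s.setEntry a i v).Bounded B := by
  refine ⟨hs.1, fun b j => ?_⟩
  simp only [Mem.setEntry, Function.update_apply]
  split_ifs with h
  · rw [Function.update_apply]
    split_ifs
    exacts [hv, hs.2 a j]
  · exact hs.2 b j

theorem size_getD_le {B : ℕ} {w : List ℕ} (hw : ∀ v ∈ w, v.size ≤ B) (i : ℕ) :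
    (w.getD i 0).size ≤ B := by
  rcases lt_or_ge i w.length with h | h
  · rw [List.getD_eq_getElem _ _ h]
    exact hw _ (List.getElem_mem h)
  · rw [List.getD_eq_default _ _ h]
    simp

theorem Mem.Bounded.setWord {B : ℕ} {s : Mem} (hs : s.Bounded B) (a k : ℕ) {w : List ℕ}
    (hl : w.length.size ≤ B) (hw : ∀ v ∈ w, v.size ≤ B) : (s.setWord a k w).Bounded B := by
  constructor
  · intro y
    simp only [Mem.setWord, Function.update_apply]
    split_ifs
    exacts [hl, hs.1 y]
  · intro b j
    simp only [Mem.setWord, Function.update_apply]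
    split_ifs
    exacts [size_getD_le hw j, hs.2 b j]

theorem wordSize_le {B : ℕ} {w : List ℕ} (hw : ∀ v ∈ w, v.size ≤ B) :
    wordSize w ≤ w.length * (B + 1) := by
  rw [wordSize, ← smul_eq_mul, ← List.length_map (f := fun a => a.size + 1)]
  refine List.sum_le_card_nsmul _ _ fun x hx => ?_
  obtain ⟨v, hv, rfl⟩ := List.mem_map.1 hx
  exact Nat.succ_le_succ (hw v hv)

/-- A condition on the initial memory under which the program halts with `Q`, while every loop is
passed at most `N` times, every query and every answer has at most `N` entries, and every number
that is written has at most `B` bits. Loops are treated by an invariant that depends on the number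
of passes. -/
def wp (O : List ℕ → List ℕ) (N B : ℕ) : Cmd → (Mem → Prop) → Mem → Prop
  | .skip, Q, s => Q s
  | .assign x e, Q, s => (e.eval s).size ≤ B ∧ Q (s.setReg x (e.eval s))
  | .store a i e, Q, s => (e.eval s).size ≤ B ∧ Q (s.setEntry a (i.eval s) (e.eval s))
  | .seq c d, Q, s => wp O N B c (wp O N B d Q) s
  | .ite e c d, Q, s => (e.eval s ≠ 0 → wp O N B c Q s) ∧ (e.eval s = 0 → wp O N B d Q s)
  | .loop e c, Q, s => ∃ n ≤ N, ∃ I : ℕ → Mem → Prop, I 0 s ∧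
      (∀ j < n, ∀ s', I j s' → e.eval s' ≠ 0 ∧ wp O N B c (I (j + 1)) s') ∧
      ∀ s', I n s' → e.eval s' = 0 ∧ Q s'
  | .query a n b k, Q, s => s.reg n ≤ N ∧ (O (s.getWord a n)).length ≤ N ∧
      (O (s.getWord a n)).length.size ≤ B ∧ (∀ v ∈ O (s.getWord a n), v.size ≤ B) ∧
      Q (s.setWord b k (O (s.getWord a n)))

/-- A bound for the running time of a program, up to a factor `B + 1`, as a polynomial in the
bound for the number of passes of each loop and the lengths of queries and answers. -/
noncomputable def Cmd.timeFactor : Cmd → Polynomial ℕ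
  | .skip => 1
  | .assign _ e => .C (e.costFactor + e.sizeFactor + 1)
  | .store _ i e => .C (i.costFactor + e.costFactor + i.sizeFactor + e.sizeFactor + 1)
  | .seq c d => c.timeFactor + d.timeFactor + 1
  | .ite e c d => .C e.costFactor + c.timeFactor + d.timeFactor + 1
  | .loop e c => .X * (.C e.costFactor + c.timeFactor + 1) + .C e.costFactor + 1
  | .query _ _ _ _ => .X + .X + 1

/-- Soundness of `wp`: it yields an execution, with a bound for its running time. -/
theorem exists_exec_of_wp {O : List ℕ → List ℕ} {N B : ℕ} (c : Cmd) {Q : Mem → Prop} {s : Mem}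
    (h : wp O N B c Q s) (hs : s.Bounded B) :
    ∃ s' t, Exec O c s s' t ∧ t ≤ c.timeFactor.eval N * (B + 1) ∧ s'.Bounded B ∧ Q s' := by
  induction c generalizing Q s with
  | skip => exact ⟨s, 1, .skip s, by simp [Cmd.timeFactor], hs, h⟩
  | assign x e =>
    refine ⟨_, _, .assign s x e, ?_, hs.setReg x h.1, h.2⟩
    have := e.size_eval_le hs
    have := e.cost_le hs
    simp only [Cmd.timeFactor, Polynomial.eval_C]
    nlinarith
  | store a i e =>
    refine ⟨_, _, .store s a i e, ?_, hs.setEntry a _ h.1, h.2⟩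
    have := e.size_eval_le hs
    have := e.cost_le hs
    have := i.size_eval_le hs
    have := i.cost_le hs
    simp only [Cmd.timeFactor, Polynomial.eval_C]
    nlinarith
  | seq c d ihc ihd =>
    obtain ⟨s1, t1, e1, ht1, hs1, h1⟩ := ihc h hs
    obtain ⟨s2, t2, e2, ht2, hs2, h2⟩ := ihd h1 hs1
    refine ⟨s2, _, .seq e1 e2, ?_, hs2, h2⟩
    simp only [Cmd.timeFactor, Polynomial.eval_add, Polynomial.eval_one]
    nlinarith
  | ite e c d ihc ihd =>
    have he := e.cost_le hs
    by_cases h0 : e.eval s = 0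
    · obtain ⟨s1, t1, e1, ht1, hs1, h1⟩ := ihd (h.2 h0) hs
      refine ⟨s1, _, .iteFalse h0 e1, ?_, hs1, h1⟩
      simp only [Cmd.timeFactor, Polynomial.eval_add, Polynomial.eval_one, Polynomial.eval_C]
      nlinarith [Nat.zero_le (c.timeFactor.eval N * (B + 1))]
    · obtain ⟨s1, t1, e1, ht1, hs1, h1⟩ := ihc (h.1 h0) hs
      refine ⟨s1, _, .iteTrue h0 e1, ?_, hs1, h1⟩
      simp only [Cmd.timeFactor, Polynomial.eval_add, Polynomial.eval_one, Polynomial.eval_C]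
      nlinarith [Nat.zero_le (d.timeFactor.eval N * (B + 1))]
  | loop e c ih =>
    obtain ⟨n, hn, I, h0, hstep, hend⟩ := h
    have key : ∀ k j, j + k = n → ∀ s, I j s → s.Bounded B →
        ∃ s' t, Exec O (.loop e c) s s' t ∧
          t ≤ (k * (e.costFactor + c.timeFactor.eval N + 1) + e.costFactor + 1) * (B + 1) ∧
          s'.Bounded B ∧ Q s' := by
      intro k
      induction k with
      | zero =>
        rintro j rfl s hI hs
        obtain ⟨he, hQ⟩ := hend s hI
        refine ⟨s, _, .loopStop he, ?_, hs, hQ⟩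
        have := e.cost_le hs
        nlinarith
      | succ k ihk =>
        intro j hj s hI hs
        obtain ⟨he, hw⟩ := hstep j (by omega) s hI
        obtain ⟨s1, t1, e1, ht1, hs1, h1⟩ := ih hw hs
        obtain ⟨s2, t2, e2, ht2, hs2, h2⟩ := ihk (j + 1) (by omega) s1 h1 hs1
        refine ⟨s2, _, .loopStep he e1 e2, ?_, hs2, h2⟩
        have := e.cost_le hs
        nlinarith
    obtain ⟨s', t, he, ht, hs', hQ⟩ := key n 0 (by omega) s h0 hs
    refine ⟨s', t, he, ht.trans (Nat.mul_le_mul_right _ ?_), hs', hQ⟩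
    simp only [Cmd.timeFactor, Polynomial.eval_add, Polynomial.eval_one, Polynomial.eval_C,
      Polynomial.eval_mul, Polynomial.eval_X]
    gcongr
  | query a n b k =>
    obtain ⟨h1, h2, h3, h4, hQ⟩ := h
    refine ⟨_, _, .query s a n b k, ?_, hs.setWord b k h3 h4, hQ⟩
    have w1 : wordSize (s.getWord a n) ≤ s.reg n * (B + 1) := by
      have := wordSize_le (B := B) (w := s.getWord a n) fun v hv => by
        obtain ⟨i, -, rfl⟩ := List.mem_map.1 hv
        exact hs.2 a i
      simpa [Mem.getWord] using this
    have w2 := wordSize_le h4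
    have w3 := Nat.mul_le_mul_right (B + 1) h1
    have w4 := Nat.mul_le_mul_right (B + 1) h2
    simp only [Cmd.timeFactor, Polynomial.eval_add, Polynomial.eval_one, Polynomial.eval_X]
    nlinarith

theorem wp_mono {O : List ℕ → List ℕ} {N B : ℕ} (c : Cmd) {P Q : Mem → Prop} {s : Mem}
    (h : wp O N B c P s) (hPQ : ∀ s, P s → Q s) : wp O N B c Q s := by
  induction c generalizing P Q s with
  | skip => exact hPQ _ h
  | assign x e => exact ⟨h.1, hPQ _ h.2⟩
  | store a i e => exact ⟨h.1, hPQ _ h.2⟩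
  | seq c d ihc ihd => exact ihc h fun s hs => ihd hs hPQ
  | ite e c d ihc ihd => exact ⟨fun h0 => ihc (h.1 h0) hPQ, fun h0 => ihd (h.2 h0) hPQ⟩
  | loop e c ih =>
    obtain ⟨n, hn, I, h0, hstep, hend⟩ := h
    exact ⟨n, hn, I, h0, hstep, fun s hs => ⟨(hend s hs).1, hPQ _ (hend s hs).2⟩⟩
  | query a n b k =>
    obtain ⟨h1, h2, h3, h4, hQ⟩ := h
    exact ⟨h1, h2, h3, h4, hPQ _ hQ⟩

/-! ### Writing words -/

theorem Mem.getWord_setWord (s : Mem) (a k : ℕ) (w : List ℕ) :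
    (s.setWord a k w).getWord a k = w := by
  refine List.ext_getElem (by simp [Mem.getWord, Mem.setWord]) fun i h1 h2 => ?_
  simp [Mem.getWord, Mem.setWord, h2]

theorem Mem.setWord_eq_self {s : Mem} {a k : ℕ} {w : List ℕ} (hk : s.reg k = w.length)
    (ha : s.arr a = fun i => w.getD i 0) : s.setWord a k w = s := by
  cases s
  simp only [Mem.setWord, Mem.mk.injEq] at *
  exact ⟨hk ▸ Function.update_eq_self _ _, ha ▸ Function.update_eq_self _ _⟩

/-- Append the values of expressions to the word in the array `1` with length register `3`. -/
def pushAll : List AExp → Cmd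
  | [] => .skip
  | e :: es => .seq (.seq (.store 1 (.reg 3) e) (.assign 3 (.reg 3 + .const 1))) (pushAll es)

theorem wp_pushAll {O : List ℕ → List ℕ} {N B : ℕ} {es : List AExp} {val : AExp → ℕ}
    {Q : Mem → Prop} {s : Mem} {L : List ℕ}
    (heval : ∀ L', ∀ e ∈ es, e.eval (s.setWord 1 3 L') = val e)
    (hsize : ∀ e ∈ es, (val e).size ≤ B) (hlen : L.length + es.length ≤ B)
    (hQ : Q (s.setWord 1 3 (L ++ es.map val))) :
    wp O N B (pushAll es) Q (s.setWord 1 3 L) := by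
  induction es generalizing L with
  | nil => simpa [pushAll, wp] using hQ
  | cons e es ih =>
    have hstep : ((s.setWord 1 3 L).setEntry 1 L.length (val e)).setReg 3 (L.length + 1) =
        s.setWord 1 3 (L ++ [val e]) := by
      simp only [Mem.setWord, Mem.setEntry, Mem.setReg, Function.update_self,
        Function.update_idem, List.length_append, List.length_singleton, Mem.mk.injEq, true_and]
      congr 1
      funext i
      rw [Function.update_apply]
      split_ifs with h
      · subst h; simp
      · rcases lt_or_gt_of_ne h with h | h
        · rw [List.getD_append _ _ _ _ h]
        · rw [List.getD_eq_default _ _ h.le, List.getD_eq_default _ _ (by simp; omega)]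
    have he := heval L e (by simp)
    have h3 : ∀ v, ((s.setWord 1 3 L).setEntry 1 L.length v).reg 3 = L.length := fun v => by
      simp [Mem.setWord, Mem.setEntry]
    have h3' : (s.setWord 1 3 L).reg 3 = L.length := by simp [Mem.setWord]
    simp only [List.length_cons] at hlen
    simp only [pushAll, wp, AExp.eval_add, AExp.eval_reg, AExp.eval_const, he, h3', h3, hstep]
    refine ⟨hsize e (by simp), (Nat.size_le.2 Nat.lt_two_pow_self).trans (by omega), ?_⟩
    refine ih (fun L' e he => heval L' e (by simp [he])) (fun e he => hsize e (by simp [he]))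
      (by simp; omega) ?_
    simpa using hQ

/-! ### The program -/

/-- An expression for `Nat.pair`. The truncated difference `1 - (1 - (b - a))` is `1` if `a < b`,
and `0` otherwise. -/
def pairExp (a b : AExp) : AExp :=
  (.const 1 - (.const 1 - (b - a))) * (b * b + a) +
    (.const 1 - (.const 1 - (.const 1 - (b - a)))) * (a * a + a + b)

/-- The `i`-th vertex on the path that replaces the current edge, whose smaller and larger end are
in the registers `9` and `10`; register `5` holds the first fresh vertex. -/
def vertexExp (K i : ℕ) : AExp :=
  if i = 0 then .reg 9
  else if i < K then .reg 5 + pairExp (pairExp (.reg 9) (.reg 10)) (.const i)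
  else .reg 10

/-- The weight `chosenWeight r q i`, where register `6` holds `q`. -/
def chosenExp (r i : ℕ) : AExp :=
  if i < 4 * r + 1 ∧ i % 2 = 1 then .const 2 * .reg 6 else .const 1

/-- The weight `unchosenWeight r q i`, where register `6` holds `q`. -/
def unchosenExp (r i : ℕ) : AExp := if i < 4 * r + 1 then .const 1 else .reg 6

/-- The number `pathDenom K r q`, where register `6` holds `q`. -/
def denomExp (r : ℕ) : ℕ → AExp
  | 0 => .const 1
  | K + 1 => denomExp r K * (chosenExp r K + unchosenExp r K)

/-- The names of the inner vertices of the path that replaces the current edge. -/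
def innerVertexExps (K : ℕ) : List AExp := (List.range (K - 1)).map fun i => vertexExp K (i + 1)

/-- The edges of the path that replaces the current edge, with their probabilities. -/
def pathEdgeExps (K r : ℕ) : List AExp :=
  (List.range K).flatMap fun i =>
    [vertexExp K i, vertexExp K (i + 1), chosenExp r i, chosenExp r i + unchosenExp r i]

/-- Sequential composition. -/
def block : List Cmd → Cmd
  | [] => .skip
  | c :: cs => .seq c (block cs)

/-- Put the smaller and the larger end of the edge with the number in register `4` into the
registers `9` and `10`. Minimum and maximum are expressed by truncated subtraction. -/
def loadEdge : Cmd :=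
  let x : AExp := .read 0 (.reg 1 + .const 2 + .const 2 * .reg 4)
  let y : AExp := .read 0 (.reg 1 + .const 3 + .const 2 * .reg 4)
  block [.assign 9 (x - (x - y)), .assign 10 (x + (y - x))]

/-- Append the current vertex to the query, and keep the first fresh vertex up to date. -/
def vertexStep : Cmd :=
  block [
    pushAll [.read 0 (.reg 4 + .const 1)],
    .assign 5 (.reg 5 + (.read 0 (.reg 4 + .const 1) + .const 1 - .reg 5)),
    .assign 4 (.reg 4 + .const 1)]

/-- Append the inner vertices of the path that replaces the current edge to the query. -/
def innerVertexStep (K r : ℕ) : Cmd :=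
  block [
    loadEdge,
    pushAll (innerVertexExps K),
    .assign 6 (.reg 6 * .const (2 ^ r * 2)),
    .assign 7 (.reg 7 * .const (2 ^ r)),
    .assign 4 (.reg 4 + .const 1)]

/-- Append the edges of the path that replaces the current edge to the query. -/
def pathEdgeStep (K r : ℕ) : Cmd :=
  block [
    loadEdge,
    pushAll (pathEdgeExps K r),
    .assign 8 (.reg 8 * denomExp r K),
    .assign 4 (.reg 4 + .const 1)]

/-- The reduction. The registers `1` and `2` hold the numbers of vertices and edges, `3` the length
of the query, `4` the number of the current vertex or edge, `5` the first fresh vertex, `6` the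
number `q`, `7` the factor that the number of matchings is multiplied by modulo `q + 1`, and `8`
the product of the denominators of all probabilities. -/
def reduction (K r : ℕ) : Cmd :=
  block [
    .assign 1 (.read 0 (.const 0)),
    .assign 2 (.read 0 (.reg 1 + .const 1)),
    .assign 5 (.const 1),
    .assign 6 (.const 1),
    .assign 7 (.const 1),
    .assign 8 (.const 1),
    pushAll [.reg 1 + .const (K - 1) * .reg 2],
    .loop (.reg 1 - .reg 4) vertexStep,
    .assign 4 (.const 0),
    .loop (.reg 2 - .reg 4) (innerVertexStep K r),
    .assign 4 (.const 0),
    pushAll [.const K * .reg 2],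
    .loop (.reg 2 - .reg 4) (pathEdgeStep K r),
    .query 1 3 2 9,
    .assign 9 (.read 2 (.const 0) * .reg 8 / .read 2 (.const 1)),
    .store 0 (.const 0) ((.reg 9 - .reg 9 / (.reg 6 + .const 1) * (.reg 6 + .const 1)) / .reg 7),
    .assign 0 (.const 1)]

/-! ### Values of the expressions -/

/-- The value of the expression does not depend on the word that is being written. -/
def AExp.Stable (e : AExp) : Prop := ∀ s L, e.eval (s.setWord 1 3 L) = e.eval s

theorem AExp.stable_const (n : ℕ) : (AExp.const n).Stable := fun _ _ => rfl
theorem AExp.stable_reg {x : ℕ} (hx : x ≠ 3) : (AExp.reg x).Stable := fun _ _ =>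
  Function.update_of_ne hx _ _
theorem AExp.Stable.read {a : ℕ} (ha : a ≠ 1) {i : AExp} (hi : i.Stable) : (AExp.read a i).Stable :=
  fun s L => by
    rw [eval_read, eval_read, hi]
    exact congrFun (Function.update_of_ne ha _ _) _
theorem AExp.Stable.add {l r : AExp} (hl : l.Stable) (hr : r.Stable) : (l + r).Stable :=
  fun s L => by rw [eval_add, eval_add, hl, hr]
theorem AExp.Stable.sub {l r : AExp} (hl : l.Stable) (hr : r.Stable) : (l - r).Stable :=
  fun s L => by rw [eval_sub, eval_sub, hl, hr]
theorem AExp.Stable.mul {l r : AExp} (hl : l.Stable) (hr : r.Stable) : (l * r).Stable :=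
  fun s L => by rw [eval_mul, eval_mul, hl, hr]

theorem stable_pairExp {a b : AExp} (ha : a.Stable) (hb : b.Stable) : (pairExp a b).Stable := by
  have h1 := AExp.stable_const 1
  exact ((h1.sub (h1.sub (hb.sub ha))).mul ((hb.mul hb).add ha)).add
    ((h1.sub (h1.sub (h1.sub (hb.sub ha)))).mul (((ha.mul ha).add ha).add hb))

theorem stable_vertexExp (K i : ℕ) : (vertexExp K i).Stable := by
  unfold vertexExp
  split_ifs
  · exact AExp.stable_reg (by decide)
  · exact (AExp.stable_reg (by decide)).add (stable_pairExp (stable_pairExp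
      (AExp.stable_reg (by decide)) (AExp.stable_reg (by decide))) (AExp.stable_const i))
  · exact AExp.stable_reg (by decide)

theorem stable_chosenExp (r i : ℕ) : (chosenExp r i).Stable := by
  unfold chosenExp
  split_ifs
  exacts [(AExp.stable_const 2).mul (AExp.stable_reg (by decide)), AExp.stable_const 1]

theorem stable_unchosenExp (r i : ℕ) : (unchosenExp r i).Stable := by
  unfold unchosenExp
  split_ifs
  exacts [AExp.stable_const 1, AExp.stable_reg (by decide)]

theorem eval_pairExp (s : Mem) (a b : AExp) :
    (pairExp a b).eval s = Nat.pair (a.eval s) (b.eval s) := by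
  simp only [pairExp, AExp.eval_add, AExp.eval_sub, AExp.eval_mul, AExp.eval_const, Nat.pair]
  split_ifs with h
  · rw [show 1 - (b.eval s - a.eval s) = 0 by omega]; simp
  · rw [show 1 - (b.eval s - a.eval s) = 1 by omega]; simp

theorem eval_vertexExp {s : Mem} {G : FinGraph} {e : Sym2 ℕ} (h5 : s.reg 5 = G.freshBase)
    (h9 : s.reg 9 = e.inf) (h10 : s.reg 10 = e.sup) (K i : ℕ) :
    (vertexExp K i).eval s = G.pathVertex K e i := by
  unfold vertexExp FinGraph.pathVertex
  split_ifs <;>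
    simp only [AExp.eval_add, AExp.eval_reg, eval_pairExp, AExp.eval_const, h5, h9, h10]

theorem eval_chosenExp (s : Mem) (r i : ℕ) :
    (chosenExp r i).eval s = chosenWeight r (s.reg 6) i := by
  unfold chosenExp chosenWeight; split_ifs <;> rfl

theorem eval_unchosenExp (s : Mem) (r i : ℕ) :
    (unchosenExp r i).eval s = unchosenWeight r (s.reg 6) i := by
  unfold unchosenExp unchosenWeight; split_ifs <;> rfl

theorem eval_denomExp (s : Mem) (K r : ℕ) : (denomExp r K).eval s = pathDenom K r (s.reg 6) := by
  induction K with
  | zero => rfl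
  | succ K ih =>
    rw [denomExp, AExp.eval_mul, AExp.eval_add, eval_chosenExp, eval_unchosenExp, ih, pathDenom,
      pathDenom, prod_range_succ]

/-- The part of the encoding of a subdivision that names the inner vertices of one path. -/
def innerVertexWord (G : FinGraph) (K : ℕ) (e : Sym2 ℕ) : List ℕ :=
  (List.range (K - 1)).map fun i => G.pathVertex K e (i + 1)

/-- The part of the encoding of a subdivision that lists the edges of one path with their
probabilities. -/
def pathEdgeWord (G : FinGraph) (K r q : ℕ) (e : Sym2 ℕ) : List ℕ :=
  (List.range K).flatMap fun i =>
    [G.pathVertex K e i, G.pathVertex K e (i + 1), chosenWeight r q i,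
      chosenWeight r q i + unchosenWeight r q i]

theorem length_innerVertexWord (G : FinGraph) (K : ℕ) (e : Sym2 ℕ) :
    (innerVertexWord G K e).length = K - 1 := by simp [innerVertexWord]

theorem length_pathEdgeWord (G : FinGraph) (K r q : ℕ) (e : Sym2 ℕ) :
    (pathEdgeWord G K r q e).length = 4 * K := by
  simp [pathEdgeWord, List.length_flatMap, mul_comm]

theorem map_eval_innerVertexExps {s : Mem} {G : FinGraph} {e : Sym2 ℕ}
    (h5 : s.reg 5 = G.freshBase) (h9 : s.reg 9 = e.inf) (h10 : s.reg 10 = e.sup) (K : ℕ) :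
    (innerVertexExps K).map (AExp.eval s) = innerVertexWord G K e := by
  rw [innerVertexExps, innerVertexWord, List.map_map]
  exact List.map_congr_left fun i _ => eval_vertexExp h5 h9 h10 K (i + 1)

theorem map_eval_pathEdgeExps {s : Mem} {G : FinGraph} {e : Sym2 ℕ}
    (h5 : s.reg 5 = G.freshBase) (h9 : s.reg 9 = e.inf) (h10 : s.reg 10 = e.sup) (K r : ℕ) :
    (pathEdgeExps K r).map (AExp.eval s) = pathEdgeWord G K r (s.reg 6) e := by
  simp only [pathEdgeExps, pathEdgeWord, List.map_flatMap, List.map_cons, List.map_nil,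
    AExp.eval_add, eval_vertexExp h5 h9 h10, eval_chosenExp, eval_unchosenExp]

theorem stable_of_mem_innerVertexExps (K : ℕ) : ∀ e ∈ innerVertexExps K, e.Stable := by
  intro e he
  obtain ⟨i, -, rfl⟩ := List.mem_map.1 he
  exact stable_vertexExp K _

theorem stable_of_mem_pathEdgeExps (K r : ℕ) : ∀ e ∈ pathEdgeExps K r, e.Stable := by
  intro e he
  obtain ⟨i, -, he⟩ := List.mem_flatMap.1 he
  simp only [List.mem_cons, List.not_mem_nil, or_false] at he
  rcases he with rfl | rfl | rfl | rfl
  exacts [stable_vertexExp K i, stable_vertexExp K _, stable_chosenExp r i,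
    (stable_chosenExp r i).add (stable_unchosenExp r i)]

/-! ### The query encodes the subdivision -/

/-- The word that is submitted to the oracle for the graph with vertices `vs` and edges `es`. -/
def queryWord (G : FinGraph) (K r q : ℕ) (vs : List ℕ) (es : List (ℕ × ℕ)) : List ℕ :=
  (vs.length + (K - 1) * es.length) ::
    vs ++ es.flatMap (fun p => innerVertexWord G K s(p.1, p.2)) ++ (K * es.length) ::
      es.flatMap fun p => pathEdgeWord G K r q s(p.1, p.2)

theorem encodesProbGraph_queryWord (G : FinGraph) {K : ℕ} (hK : 2 ≤ K) (r : ℕ) {q : ℕ}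
    (hq : 0 < q) {vs : List ℕ} {es : List (ℕ × ℕ)} (hvs : vs.Nodup) (hV : vs.toFinset = G.V)
    (hes : (es.map fun p => s(p.1, p.2)).Nodup)
    (hE : (es.map fun p => s(p.1, p.2)).toFinset = G.E) :
    EncodesProbGraph (queryWord G K r q vs es) (G.sub K) (G.pathProb K r q) := by
  have hmem : ∀ e : Sym2 ℕ, e ∈ G.E ↔ ∃ p ∈ es, s(p.1, p.2) = e := by
    intro e
    rw [← hE, List.mem_toFinset, List.mem_map]
  have hmem' : ∀ p ∈ es, s(p.1, p.2) ∈ G.E := fun p hp => (hmem _).2 ⟨p, hp, rfl⟩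
  have hpair : es.Pairwise fun p p' => s(p.1, p.2) ≠ s(p'.1, p'.2) := List.pairwise_map.1 hes
  refine ⟨vs ++ es.flatMap fun p => innerVertexWord G K s(p.1, p.2),
    es.flatMap fun p => (List.range K).map fun i =>
      (G.pathVertex K s(p.1, p.2) i, G.pathVertex K s(p.1, p.2) (i + 1), chosenWeight r q i,
        chosenWeight r q i + unchosenWeight r q i), ?_, ?_, ?_, ?_, ?_, ?_⟩
  · rw [List.nodup_append]
    refine ⟨hvs, ?_, ?_⟩
    · rw [List.nodup_flatMap]
      constructor
      · intro p hp
        rw [innerVertexWord, List.nodup_map_iff_inj_on List.nodup_range]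
        intro i hi j hj h
        have hi := List.mem_range.1 hi
        have := (G.eq_of_pathVertex_eq (by omega) (by omega) (hmem' p hp) h).2
        omega
      · refine (hpair.imp_of_mem ?_)
        intro p p' hp hp' hne
        refine List.disjoint_left.2 fun v hv hv' => hne ?_
        obtain ⟨i, hi, rfl⟩ := List.mem_map.1 hv
        obtain ⟨j, hj, h⟩ := List.mem_map.1 hv'
        have hi := List.mem_range.1 hi
        exact (G.eq_of_pathVertex_eq (by omega) (by omega) (hmem' p' hp') h.symm).1
    · intro v hv v' hv' h
      subst h
      have hv : v ∈ G.V := hV ▸ List.mem_toFinset.2 hv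
      obtain ⟨p, hp, hv'⟩ := List.mem_flatMap.1 hv'
      obtain ⟨i, hi, rfl⟩ := List.mem_map.1 hv'
      have hi := List.mem_range.1 hi
      have := G.lt_freshBase hv
      rw [G.pathVertex_inner (by omega) (by omega)] at this
      omega
  · ext v
    simp only [FinGraph.sub, List.toFinset_append, mem_union, hV, List.mem_toFinset,
      List.mem_flatMap, mem_biUnion, mem_image, mem_range]
    constructor
    · rintro (h | ⟨p, hp, h⟩)
      · exact .inl h
      · obtain ⟨i, hi, rfl⟩ := List.mem_map.1 h
        have hi := List.mem_range.1 hi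
        exact .inr ⟨_, hmem' p hp, i + 1, by omega, rfl⟩
    · rintro (h | ⟨e, he, i, hi, rfl⟩)
      · exact .inl h
      · rcases Nat.eq_zero_or_pos i with rfl | h0
        · rw [G.pathVertex_zero]
          exact .inl (G.mem_V e he _ ((FinGraph.mem_iff_inf_sup e _).2 (.inl rfl)))
        · rcases Nat.lt_or_ge i K with hiK | hiK
          · obtain ⟨p, hp, rfl⟩ := (hmem e).1 he
            refine .inr ⟨p, hp, List.mem_map.2 ⟨i - 1, List.mem_range.2 (by omega), ?_⟩⟩
            rw [Nat.sub_add_cancel h0]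
          · obtain rfl : i = K := by omega
            rw [G.pathVertex_self h0]
            exact .inl (G.mem_V e he _ ((FinGraph.mem_iff_inf_sup e _).2 (.inr rfl)))
  · rw [List.map_flatMap, List.nodup_flatMap]
    constructor
    · intro p hp
      rw [List.map_map, List.nodup_map_iff_inj_on List.nodup_range]
      intro i hi j hj h
      exact (G.pathEdge_injective hK (hmem' p hp) (hmem' p hp) (List.mem_range.1 hi)
        (List.mem_range.1 hj) h).2
    · refine (hpair.imp_of_mem ?_)
      intro p p' hp hp' hne
      refine List.disjoint_left.2 fun f hf hf' => hne ?_
      obtain ⟨_, hx, rfl⟩ := List.mem_map.1 hf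
      obtain ⟨i, hi, rfl⟩ := List.mem_map.1 hx
      obtain ⟨_, hy, h⟩ := List.mem_map.1 hf'
      obtain ⟨j, hj, rfl⟩ := List.mem_map.1 hy
      exact (G.pathEdge_injective hK (hmem' p' hp') (hmem' p hp) (List.mem_range.1 hj)
        (List.mem_range.1 hi) h).1.symm
  · ext f
    rw [List.mem_toFinset, List.map_flatMap, List.mem_flatMap, G.mem_sub_E]
    constructor
    · rintro ⟨p, hp, hf⟩
      rw [List.map_map] at hf
      obtain ⟨i, hi, rfl⟩ := List.mem_map.1 hf
      exact ⟨_, hmem' p hp, i, List.mem_range.1 hi, rfl⟩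
    · rintro ⟨e, he, i, hi, rfl⟩
      obtain ⟨p, hp, rfl⟩ := (hmem e).1 he
      refine ⟨p, hp, ?_⟩
      rw [List.map_map]
      exact List.mem_map.2 ⟨i, List.mem_range.2 hi, rfl⟩
  · intro x y a b h
    obtain ⟨p, hp, h⟩ := List.mem_flatMap.1 h
    obtain ⟨i, hi, h⟩ := List.mem_map.1 h
    obtain ⟨rfl, rfl, rfl, rfl⟩ : _ ∧ _ ∧ _ ∧ _ := by simpa only [Prod.mk.injEq] using h
    refine ⟨(Nat.add_pos_left (chosenWeight_pos r i hq) _).ne', ?_⟩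
    have := G.position_pathEdge hK (hmem' p hp) (List.mem_range.1 hi)
    rw [FinGraph.pathEdge] at this
    rw [FinGraph.pathProb, this]
  · have h1 : (es.flatMap fun p => innerVertexWord G K s(p.1, p.2)).length =
        (K - 1) * es.length := by
      simp [List.length_flatMap, length_innerVertexWord, mul_comm]
    have h2 : (es.flatMap fun p => (List.range K).map fun i =>
      (G.pathVertex K s(p.1, p.2) i, G.pathVertex K s(p.1, p.2) (i + 1), chosenWeight r q i,
        chosenWeight r q i + unchosenWeight r q i)).length = K * es.length := by
      simp [List.length_flatMap, mul_comm]
    rw [queryWord, List.length_append, h1, h2, List.flatMap_assoc]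
    simp only [List.flatMap_map, pathEdgeWord, List.cons_append]

/-! ### Memory invariant and parsing of the input -/

/-- The state of the memory during the reduction: the input word is `w`, the word `L` has been
written, and the registers `1, 2, 4, …, 8` hold the given numbers. -/
structure Inv (w L : List ℕ) (nv m j base q cm d : ℕ) (s : Mem) : Prop where
  input : s.arr 0 = fun i => w.getD i 0
  output : s.arr 1 = fun i => L.getD i 0
  length : s.reg 3 = L.length
  reg1 : s.reg 1 = nv
  reg2 : s.reg 2 = m
  reg4 : s.reg 4 = j
  reg5 : s.reg 5 = base
  reg6 : s.reg 6 = q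
  reg7 : s.reg 7 = cm
  reg8 : s.reg 8 = d

section
variable {w L : List ℕ} {nv m j base q cm d : ℕ} {s : Mem}

theorem Inv.setWord (h : Inv w L nv m j base q cm d s) (L' : List ℕ) :
    Inv w L' nv m j base q cm d (s.setWord 1 3 L') := by
  constructor <;> simp [Mem.setWord, h.input, h.reg1, h.reg2, h.reg4, h.reg5, h.reg6, h.reg7,
    h.reg8]

theorem Inv.setReg_of_lt (h : Inv w L nv m j base q cm d s) {x : ℕ} (hx : 8 < x) (v : ℕ) :
    Inv w L nv m j base q cm d (s.setReg x v) := by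
  have h0 : ∀ y < 9, (s.setReg x v).reg y = s.reg y := fun y hy =>
    Function.update_of_ne (by omega) _ _
  constructor <;>
    first
    | exact h.input
    | exact h.output
    | rw [h0 _ (by decide)]
      first
      | exact h.length | exact h.reg1 | exact h.reg2 | exact h.reg4 | exact h.reg5
      | exact h.reg6 | exact h.reg7 | exact h.reg8

theorem Inv.setReg4 (h : Inv w L nv m j base q cm d s) (v : ℕ) :
    Inv w L nv m v base q cm d (s.setReg 4 v) := by
  constructor <;> simp [Mem.setReg, h.input, h.output, h.length, h.reg1, h.reg2, h.reg5, h.reg6,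
    h.reg7, h.reg8]

theorem Inv.setReg5 (h : Inv w L nv m j base q cm d s) (v : ℕ) :
    Inv w L nv m j v q cm d (s.setReg 5 v) := by
  constructor <;> simp [Mem.setReg, h.input, h.output, h.length, h.reg1, h.reg2, h.reg4, h.reg6,
    h.reg7, h.reg8]

theorem Inv.setReg6 (h : Inv w L nv m j base q cm d s) (v : ℕ) :
    Inv w L nv m j base v cm d (s.setReg 6 v) := by
  constructor <;> simp [Mem.setReg, h.input, h.output, h.length, h.reg1, h.reg2, h.reg4, h.reg5,
    h.reg7, h.reg8]

theorem Inv.setReg7 (h : Inv w L nv m j base q cm d s) (v : ℕ) :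
    Inv w L nv m j base q v d (s.setReg 7 v) := by
  constructor <;> simp [Mem.setReg, h.input, h.output, h.length, h.reg1, h.reg2, h.reg4, h.reg5,
    h.reg6, h.reg8]

theorem Inv.setReg8 (h : Inv w L nv m j base q cm d s) (v : ℕ) :
    Inv w L nv m j base q cm v (s.setReg 8 v) := by
  constructor <;> simp [Mem.setReg, h.input, h.output, h.length, h.reg1, h.reg2, h.reg4, h.reg5,
    h.reg6, h.reg7]

end

section
variable {O : List ℕ → List ℕ} {N B : ℕ} {w L : List ℕ} {nv m j base q cm d : ℕ}

theorem wp_pushAll_of_inv {s : Mem} (h : Inv w L nv m j base q cm d s) {es : List AExp}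
    {X : List ℕ} {Q : Mem → Prop} (hst : ∀ e ∈ es, e.Stable) (hX : es.map (AExp.eval s) = X)
    (hsize : ∀ x ∈ X, x.size ≤ B) (hlen : L.length + X.length ≤ B)
    (hQ : Q (s.setWord 1 3 (L ++ X))) : wp O N B (pushAll es) Q s := by
  subst hX
  rw [List.length_map] at hlen
  rw [← Mem.setWord_eq_self h.length h.output]
  exact wp_pushAll (val := AExp.eval s) (fun L' e he => hst e he s L')
    (fun e he => hsize _ (List.mem_map_of_mem he)) hlen hQ

theorem wp_loadEdge {s : Mem} (h : Inv w L nv m j base q cm d s) {x y : ℕ} {Q : Mem → Prop}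
    (hx : w.getD (nv + 2 + 2 * j) 0 = x) (hy : w.getD (nv + 3 + 2 * j) 0 = y)
    (hxB : x.size ≤ B) (hyB : y.size ≤ B)
    (hQ : ∀ s', Inv w L nv m j base q cm d s' → s'.reg 9 = s(x, y).inf → s'.reg 10 = s(x, y).sup →
      Q s') : wp O N B loadEdge Q s := by
  have h9 : ∀ v, (s.setReg 9 v).arr 0 = s.arr 0 := fun _ => rfl
  have h9' : ∀ v, (s.setReg 9 v).reg 1 = s.reg 1 := fun _ => by simp [Mem.setReg]
  have h9'' : ∀ v, (s.setReg 9 v).reg 4 = s.reg 4 := fun _ => by simp [Mem.setReg]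
  have e1 : x - (x - y) = s(x, y).inf := by
    change _ = min x y
    omega
  have e2 : x + (y - x) = s(x, y).sup := by
    change _ = max x y
    omega
  simp only [loadEdge, block, wp, AExp.eval_add, AExp.eval_sub, AExp.eval_mul, AExp.eval_read,
    AExp.eval_const, AExp.eval_reg, h9, h9', h9'', h.input, h.reg1, h.reg4, hx, hy, e1, e2]
  refine ⟨?_, ?_, hQ _ ((h.setReg_of_lt (by decide) _).setReg_of_lt (by decide) _) ?_ ?_⟩
  · exact (Nat.size_le_size (min_le_left _ _)).trans hxB
  · change (max x y).size ≤ B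
    rcases max_cases x y with h | h <;> rw [h.1] <;> assumption
  · simp [Mem.setReg]
  · simp [Mem.setReg]

/-- A loop that counts register `4` up to the value of another register. -/
theorem wp_loop_up {body : Cmd} {n x : ℕ} {s : Mem} {I : ℕ → Mem → Prop} (hn : n ≤ N)
    (h0 : I 0 s) (hI : ∀ j s', I j s' → s'.reg x = n ∧ s'.reg 4 = j)
    (hstep : ∀ j < n, ∀ s', I j s' → wp O N B body (I (j + 1)) s') :
    wp O N B (.loop (.reg x - .reg 4) body) (I n) s := by
  refine ⟨n, hn, I, h0, fun j hj s' hs' => ⟨?_, hstep j hj s' hs'⟩, fun s' hs' => ⟨?_, hs'⟩⟩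
  · rw [AExp.eval_sub, AExp.eval_reg, AExp.eval_reg, (hI j s' hs').1, (hI j s' hs').2]
    omega
  · rw [AExp.eval_sub, AExp.eval_reg, AExp.eval_reg, (hI n s' hs').1, (hI n s' hs').2]
    omega

end

theorem size_le_of_le {v N B : ℕ} (hv : v ≤ N) (hN : N ≤ B) : v.size ≤ B :=
  (Nat.size_le.2 Nat.lt_two_pow_self).trans (hv.trans hN)

theorem flatMap_take_succ {α β : Type*} (l : List α) (f : α → List β) {j : ℕ} (hj : j < l.length) :
    (l.take (j + 1)).flatMap f = (l.take j).flatMap f ++ f l[j] := by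
  rw [← List.take_concat_get' l j hj, List.flatMap_append, List.flatMap_singleton]

theorem length_flatMap_of_const {α β : Type*} (l : List α) (f : α → List β) {k : ℕ}
    (hf : ∀ a, (f a).length = k) : (l.flatMap f).length = l.length * k := by
  simp [List.length_flatMap, hf]

/-- The data of an input word that encodes a graph. -/
structure IsInput (w : List ℕ) (G : FinGraph) (vs : List ℕ) (es : List (ℕ × ℕ)) : Prop where
  nodup_vs : vs.Nodup
  toFinset_vs : vs.toFinset = G.V
  nodup_es : (es.map fun p => s(p.1, p.2)).Nodup
  toFinset_es : (es.map fun p => s(p.1, p.2)).toFinset = G.E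
  eq : w = vs.length :: vs ++ es.length :: es.flatMap fun p => [p.1, p.2]

namespace IsInput
variable {w : List ℕ} {G : FinGraph} {vs : List ℕ} {es : List (ℕ × ℕ)}

theorem getD_zero (h : IsInput w G vs es) : w.getD 0 0 = vs.length := by rw [h.eq]; rfl

theorem getD_vertex (h : IsInput w G vs es) {i : ℕ} (hi : i < vs.length) :
    w.getD (i + 1) 0 = vs[i] := by
  rw [h.eq, List.cons_append, List.getD_cons_succ, List.getD_append _ _ _ _ hi,
    List.getD_eq_getElem]

theorem getD_length (h : IsInput w G vs es) : w.getD (vs.length + 1) 0 = es.length := by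
  rw [h.eq, List.cons_append, List.getD_cons_succ, List.getD_append_right _ _ _ _ le_rfl,
    Nat.sub_self, List.getD_cons_zero]

theorem getD_flatMap (es : List (ℕ × ℕ)) {j : ℕ} (hj : j < es.length) :
    (es.flatMap fun p => [p.1, p.2]).getD (2 * j) 0 = es[j].1 ∧
      (es.flatMap fun p => [p.1, p.2]).getD (2 * j + 1) 0 = es[j].2 := by
  induction es generalizing j with
  | nil => simp at hj
  | cons p es ih =>
    cases j with
    | zero => simp
    | succ j =>
      have := ih (j := j) (by simpa using hj)
      simpa [List.flatMap_cons, Nat.mul_succ] using this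

theorem getD_edge (h : IsInput w G vs es) {j : ℕ} (hj : j < es.length) :
    w.getD (vs.length + 2 + 2 * j) 0 = es[j].1 ∧ w.getD (vs.length + 3 + 2 * j) 0 = es[j].2 := by
  have key : ∀ i, w.getD (vs.length + 2 + i) 0 =
      (es.flatMap fun p => [p.1, p.2]).getD i 0 := by
    intro i
    rw [h.eq, List.cons_append, show vs.length + 2 + i = vs.length + (i + 1) + 1 by omega,
      List.getD_cons_succ, List.getD_append_right _ _ _ _ (by omega), Nat.add_sub_cancel_left,
      List.getD_cons_succ]
  have := getD_flatMap es hj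
  rw [← key, ← key] at this
  exact ⟨this.1, by rw [← this.2]; congr 1; omega⟩

theorem card_E (h : IsInput w G vs es) : G.E.card = es.length := by
  rw [← h.toFinset_es, List.toFinset_card_of_nodup h.nodup_es, List.length_map]

theorem getElem_mem_E (h : IsInput w G vs es) {j : ℕ} (hj : j < es.length) :
    s(es[j].1, es[j].2) ∈ G.E := by
  rw [← h.toFinset_es, List.mem_toFinset]
  exact List.mem_map.2 ⟨_, List.getElem_mem hj, rfl⟩

end IsInput

theorem length_queryWord (G : FinGraph) (K r q : ℕ) (vs : List ℕ) (es : List (ℕ × ℕ)) :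
    (queryWord G K r q vs es).length =
      vs.length + es.length * (K - 1) + es.length * (4 * K) + 2 := by
  simp only [queryWord, List.length_append, List.length_cons,
    length_flatMap_of_const es _ fun p => length_innerVertexWord G K s(p.1, p.2),
    length_flatMap_of_const es _ fun p => length_pathEdgeWord G K r q s(p.1, p.2)]
  ring

/-- The numbers that occur in the computation on the graph `G` have at most `B` bits. -/
structure FitsIn (B K r q : ℕ) (w : List ℕ) (G : FinGraph) : Prop where
  input : ∀ v ∈ w, v.size ≤ B
  fresh : G.freshBase.size ≤ B
  vertex : ∀ e ∈ G.E, ∀ i, i ≤ K → (G.pathVertex K e i).size ≤ B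
  modulus : q.size ≤ B
  denom : (pathDenom K r q ^ G.E.card).size ≤ B

/-! ### Correctness of the program -/

section Loops
variable {O : List ℕ → List ℕ} {N B K r q : ℕ} {w L : List ℕ} {G : FinGraph} {vs : List ℕ}
  {es : List (ℕ × ℕ)} {s : Mem}

theorem wp_vertexLoop (hin : IsInput w G vs es) (hB : FitsIn B K r q w G) (hN : vs.length ≤ N)
    (hL : L.length + vs.length ≤ B)
    (hs : Inv w L vs.length es.length 0 1 1 1 1 s) :
    wp O N B (.loop (.reg 1 - .reg 4) vertexStep)
      (Inv w (L ++ vs) vs.length es.length vs.length G.freshBase 1 1 1) s := by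
  have key := wp_loop_up (O := O) (N := N) (B := B) (x := 1) (n := vs.length) (s := s)
    (body := vertexStep)
    (I := fun j => Inv w (L ++ vs.take j) vs.length es.length j
      ((vs.take j).toFinset.sup id + 1) 1 1 1) hN (by simpa using hs)
    (fun j s' hs' => ⟨hs'.reg1, hs'.reg4⟩) ?_
  · rw [List.take_length, hin.toFinset_vs] at key
    exact key
  intro j hj s' hs'
  have hv : s'.arr 0 (j + 1) = vs[j] := by rw [hs'.input]; exact hin.getD_vertex hj
  refine wp_pushAll_of_inv hs' (X := [vs[j]]) ?_ ?_ ?_ ?_ ?_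
  · intro e he
    rw [List.mem_singleton.1 he]
    exact AExp.Stable.read (by decide) ((AExp.stable_reg (by decide)).add (AExp.stable_const 1))
  · simp only [List.map_cons, List.map_nil, AExp.eval_read, AExp.eval_add, AExp.eval_reg,
      AExp.eval_const, hs'.reg4, hv]
  · intro x hx
    rw [List.mem_singleton.1 hx, ← hin.getD_vertex hj]
    exact size_getD_le hB.input _
  · rw [List.length_append, List.length_take_of_le hj.le, List.length_singleton]
    omega
  have h2 := hs'.setWord (L ++ vs.take j ++ [vs[j]])
  set s2 := s'.setWord 1 3 (L ++ vs.take j ++ [vs[j]])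
  have hv2 : s2.arr 0 (j + 1) = vs[j] := by rw [h2.input]; exact hin.getD_vertex hj
  have hbase : (vs.take j).toFinset.sup id + 1 + (vs[j] + 1 - ((vs.take j).toFinset.sup id + 1)) =
      (vs.take (j + 1)).toFinset.sup id + 1 := by
    rw [← List.take_concat_get' vs j hj, List.toFinset_append, Finset.sup_union]
    have h0 : [vs[j]].toFinset.sup id = vs[j] := by simp
    rw [h0]
    change _ = max _ _ + 1
    omega
  have h3 := (h2.setReg5 ((vs.take (j + 1)).toFinset.sup id + 1)).setReg4 (j + 1)
  simp only [block, wp, AExp.eval_add, AExp.eval_sub, AExp.eval_read, AExp.eval_const,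
    AExp.eval_reg, h2.reg5, h2.reg4, hv2, hbase]
  rw [(h2.setReg5 _).reg4]
  refine ⟨?_, size_le_of_le (show j + 1 ≤ vs.length by omega) (by omega), ?_⟩
  · refine (Nat.size_le_size (Nat.succ_le_succ ?_)).trans hB.fresh
    rw [← hin.toFinset_vs]
    refine Finset.sup_mono fun v hv => ?_
    rw [List.mem_toFinset] at hv ⊢
    exact List.mem_of_mem_take hv
  · have ht : L ++ vs.take j ++ [vs[j]] = L ++ vs.take (j + 1) := by
      rw [List.append_assoc, List.take_concat_get' vs j hj]
    rwa [ht] at h3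

theorem wp_innerVertexLoop (hin : IsInput w G vs es) (hB : FitsIn B K r q w G)
    (hq : q = (2 ^ r * 2) ^ es.length) (hN : es.length ≤ N)
    (hL : L.length + es.length * (K - 1) ≤ B) (hNB : N ≤ B)
    (hs : Inv w L vs.length es.length 0 G.freshBase 1 1 1 s) :
    wp O N B (.loop (.reg 2 - .reg 4) (innerVertexStep K r))
      (Inv w (L ++ es.flatMap fun p => innerVertexWord G K s(p.1, p.2)) vs.length es.length
        es.length G.freshBase q ((2 ^ r) ^ es.length) 1) s := by
  have key := wp_loop_up (O := O) (N := N) (B := B) (x := 2) (n := es.length) (s := s)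
    (body := innerVertexStep K r)
    (I := fun j => Inv w (L ++ (es.take j).flatMap fun p => innerVertexWord G K s(p.1, p.2))
      vs.length es.length j G.freshBase ((2 ^ r * 2) ^ j) ((2 ^ r) ^ j) 1) hN (by simpa using hs)
    (fun j s' hs' => ⟨hs'.reg2, hs'.reg4⟩) ?_
  · rwa [List.take_length, ← hq] at key
  intro j hj s' hs'
  obtain ⟨hx, hy⟩ := hin.getD_edge hj
  refine wp_loadEdge hs' hx hy (by rw [← hx]; exact size_getD_le hB.input _)
    (by rw [← hy]; exact size_getD_le hB.input _)
    fun s1 h1 h9 h10 => ?_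
  refine wp_pushAll_of_inv h1 (stable_of_mem_innerVertexExps K)
    (map_eval_innerVertexExps h1.reg5 h9 h10 K) ?_ ?_ ?_
  · intro v hv
    obtain ⟨i, hi, rfl⟩ := List.mem_map.1 hv
    have hi := List.mem_range.1 hi
    exact hB.vertex _ (hin.getElem_mem_E hj) _ (by omega)
  · have hlen : ((es.take j).flatMap fun p => innerVertexWord G K s(p.1, p.2)).length =
        j * (K - 1) := by
      rw [length_flatMap_of_const _ _ fun p => length_innerVertexWord G K _,
        List.length_take_of_le hj.le]
    rw [List.length_append, length_innerVertexWord, hlen]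
    have := Nat.mul_le_mul_right (K - 1) (Nat.succ_le_of_lt hj)
    rw [Nat.succ_mul] at this
    omega
  rw [List.append_assoc, ← flatMap_take_succ es _ hj]
  have h2 := h1.setWord (L ++ (es.take (j + 1)).flatMap fun p => innerVertexWord G K s(p.1, p.2))
  set s2 := s1.setWord 1 3 (L ++ (es.take (j + 1)).flatMap fun p => innerVertexWord G K s(p.1, p.2))
  have h3 := h2.setReg6 ((2 ^ r * 2) ^ (j + 1))
  have h4 := h3.setReg7 ((2 ^ r) ^ (j + 1))
  simp only [block, wp, AExp.eval_add, AExp.eval_mul, AExp.eval_const, AExp.eval_reg, h2.reg6,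
    ← pow_succ (2 ^ r * 2) j, h3.reg7, ← pow_succ (2 ^ r) j, h4.reg4]
  have hq' : (2 ^ r * 2) ^ (j + 1) ≤ q := hq ▸ Nat.pow_le_pow_right (by positivity) hj
  refine ⟨(Nat.size_le_size hq').trans hB.modulus, ?_,
    size_le_of_le (show j + 1 ≤ N by omega) hNB, h4.setReg4 _⟩
  refine (Nat.size_le_size (le_trans ?_ hq')).trans hB.modulus
  exact Nat.pow_le_pow_left (Nat.le_mul_of_pos_right _ two_pos) _

theorem wp_pathEdgeLoop (hin : IsInput w G vs es) (hB : FitsIn B K r q w G) {cm : ℕ} (hq : 0 < q)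
    (hN : es.length ≤ N) (hL : L.length + es.length * (4 * K) ≤ B) (hNB : N ≤ B)
    (hs : Inv w L vs.length es.length 0 G.freshBase q cm 1 s) :
    wp O N B (.loop (.reg 2 - .reg 4) (pathEdgeStep K r))
      (Inv w (L ++ es.flatMap fun p => pathEdgeWord G K r q s(p.1, p.2)) vs.length es.length
        es.length G.freshBase q cm (pathDenom K r q ^ es.length)) s := by
  have key := wp_loop_up (O := O) (N := N) (B := B) (x := 2) (n := es.length) (s := s)
    (body := pathEdgeStep K r)
    (I := fun j => Inv w (L ++ (es.take j).flatMap fun p => pathEdgeWord G K r q s(p.1, p.2))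
      vs.length es.length j G.freshBase q cm (pathDenom K r q ^ j)) hN (by simpa using hs)
    (fun j s' hs' => ⟨hs'.reg2, hs'.reg4⟩) ?_
  · rwa [List.take_length] at key
  intro j hj s' hs'
  obtain ⟨hx, hy⟩ := hin.getD_edge hj
  refine wp_loadEdge hs' hx hy (by rw [← hx]; exact size_getD_le hB.input _)
    (by rw [← hy]; exact size_getD_le hB.input _)
    fun s1 h1 h9 h10 => ?_
  have hD := pathDenom_pos K r hq
  have hweight : ∀ i < K, chosenWeight r q i + unchosenWeight r q i ≤
      pathDenom K r q ^ G.E.card := by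
    intro i hi
    refine (Nat.le_of_dvd hD (dvd_prod_of_mem _ (mem_range.2 hi))).trans ?_
    refine Nat.le_self_pow ?_ _
    rw [hin.card_E]; omega
  refine wp_pushAll_of_inv h1 (stable_of_mem_pathEdgeExps K r)
    ((map_eval_pathEdgeExps h1.reg5 h9 h10 K r).trans (by rw [h1.reg6])) ?_ ?_ ?_
  · intro v hv
    obtain ⟨i, hi, hv⟩ := List.mem_flatMap.1 hv
    have hi := List.mem_range.1 hi
    simp only [List.mem_cons, List.not_mem_nil, or_false] at hv
    have he := hin.getElem_mem_E hj
    rcases hv with rfl | rfl | rfl | rfl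
    · exact hB.vertex _ he _ hi.le
    · exact hB.vertex _ he _ hi
    · exact (Nat.size_le_size ((Nat.le_add_right _ _).trans (hweight i hi))).trans hB.denom
    · exact (Nat.size_le_size (hweight i hi)).trans hB.denom
  · have hlen : ((es.take j).flatMap fun p => pathEdgeWord G K r q s(p.1, p.2)).length =
        j * (4 * K) := by
      rw [length_flatMap_of_const _ _ fun p => length_pathEdgeWord G K r q _,
        List.length_take_of_le hj.le]
    rw [List.length_append, length_pathEdgeWord, hlen]
    have := Nat.mul_le_mul_right (4 * K) (Nat.succ_le_of_lt hj)
    rw [Nat.succ_mul] at this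
    omega
  rw [List.append_assoc, ← flatMap_take_succ es _ hj]
  have h2 := h1.setWord (L ++ (es.take (j + 1)).flatMap fun p => pathEdgeWord G K r q s(p.1, p.2))
  set s2 := s1.setWord 1 3
    (L ++ (es.take (j + 1)).flatMap fun p => pathEdgeWord G K r q s(p.1, p.2))
  have h3 := h2.setReg8 (pathDenom K r q ^ (j + 1))
  simp only [block, wp, AExp.eval_add, AExp.eval_mul, AExp.eval_const, AExp.eval_reg, h2.reg8,
    eval_denomExp, h2.reg6, ← pow_succ, h3.reg4]
  refine ⟨?_, size_le_of_le (show j + 1 ≤ N by omega) hNB, h3.setReg4 _⟩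
  refine (Nat.size_le_size (Nat.pow_le_pow_right hD ?_)).trans hB.denom
  rw [hin.card_E]; omega

end Loops

section Block
variable {O : List ℕ → List ℕ} {N B : ℕ} {Q : Mem → Prop} {s : Mem} {cs : List Cmd}

theorem wp_block_cons {P : Mem → Prop} {c : Cmd} (hc : wp O N B c P s)
    (h : ∀ s', P s' → wp O N B (block cs) Q s') : wp O N B (block (c :: cs)) Q s :=
  wp_mono c hc h

theorem wp_block_assign {x v : ℕ} {e : AExp} (he : e.eval s = v) (hv : v.size ≤ B)
    (h : wp O N B (block cs) Q (s.setReg x v)) :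
    wp O N B (block (.assign x e :: cs)) Q s := by
  subst he
  exact ⟨hv, h⟩

theorem wp_block_store {a v : ℕ} {i e : AExp} {k : ℕ} (hi : i.eval s = k) (he : e.eval s = v)
    (hv : v.size ≤ B) (h : wp O N B (block cs) Q (s.setEntry a k v)) :
    wp O N B (block (.store a i e :: cs)) Q s := by
  subst he hi
  exact ⟨hv, h⟩

end Block

/-- The program computes the number of matchings whenever the oracle answers the single query
correctly. -/
theorem wp_reduction {O : List ℕ → List ℕ} {N B K r q : ℕ} {w : List ℕ} {G : FinGraph}
    {vs : List ℕ} {es : List (ℕ × ℕ)} {p : ℚ} (hK : 7 ≤ K) (hr : r = (K - 1) % 3)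
    (hq : q = (2 ^ r * 2) ^ es.length) (hin : IsInput w G vs es) (hB : FitsIn B K r q w G)
    (hN : (queryWord G K r q vs es).length ≤ N) (hNB : N ≤ B)
    (hp : p = (G.sub K).prMatching (G.pathProb K r q))
    (hO : O (queryWord G K r q vs es) = [p.num.toNat, p.den]) :
    wp O N B (reduction K r) (fun s => s.getWord 0 0 = [G.numMatchings]) (initMem w) := by
  have hlen := hN
  rw [length_queryWord] at hlen
  have hq0 : 0 < q := hq ▸ pow_pos (by positivity) _
  have hsz : ∀ v ≤ N, v.size ≤ B := fun v hv => size_le_of_le hv hNB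
  have hK1 : es.length * (4 * K) = es.length * K + 3 * (es.length * K) := by ring
  have hK2 : es.length ≤ es.length * K := Nat.le_mul_of_pos_right _ (by omega)
  have hK3 : (K - 1) * es.length = es.length * (K - 1) := mul_comm _ _
  have hK4 : K * es.length = es.length * K := mul_comm _ _
  have hw0 : (initMem w).arr 0 = fun i => w.getD i 0 := by simp [initMem, Mem.setWord]
  have h1 : Inv w [] vs.length es.length 0 1 1 1 1
      (((((((initMem w).setReg 1 vs.length).setReg 2 es.length).setReg 5 1).setReg 6 1).setReg 7
        1).setReg 8 1) := by
    constructor <;> simp [Mem.setReg, initMem, Mem.setWord]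
  have e1 : (AExp.read 0 (.const 0)).eval (initMem w) = vs.length := by
    rw [AExp.eval_read, hw0]; exact hin.getD_zero
  have e2 : (AExp.read 0 (.reg 1 + .const 1)).eval ((initMem w).setReg 1 vs.length) =
      es.length := by
    have : ((initMem w).setReg 1 vs.length).reg 1 = vs.length := by simp [Mem.setReg]
    rw [AExp.eval_read, AExp.eval_add, AExp.eval_reg, this]
    exact (congrFun hw0 _).trans hin.getD_length
  have hs1 := hsz 1 (by omega)
  refine wp_block_assign e1 (hsz _ (by omega)) ?_
  refine wp_block_assign e2 (hsz _ (by omega)) ?_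
  refine wp_block_assign rfl hs1 (wp_block_assign rfl hs1 (wp_block_assign rfl hs1
    (wp_block_assign rfl hs1 ?_)))
  rw [AExp.eval_const]
  set s1 := (((((((initMem w).setReg 1 vs.length).setReg 2 es.length).setReg 5 1).setReg 6
    1).setReg 7 1).setReg 8 1)
  -- the number of vertices of the subdivision
  refine wp_block_cons (P := Inv w [vs.length + (K - 1) * es.length] vs.length es.length 0 1 1 1 1)
    (wp_pushAll_of_inv h1 (X := [vs.length + (K - 1) * es.length]) ?_ ?_ ?_ ?_ (h1.setWord _))
    fun s2 h2 => ?_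
  · intro e he
    rw [List.mem_singleton.1 he]
    exact (AExp.stable_reg (by decide)).add
      ((AExp.stable_const _).mul (AExp.stable_reg (by decide)))
  · simp only [List.map_cons, List.map_nil, AExp.eval_add, AExp.eval_mul, AExp.eval_const,
      AExp.eval_reg, h1.reg1, h1.reg2]
  · intro v hv
    rw [List.mem_singleton.1 hv]
    exact hsz _ (by omega)
  · simp only [List.length_nil, List.length_singleton]
    omega
  refine wp_block_cons (wp_vertexLoop hin hB (by omega)
    (by simp only [List.length_singleton]; omega) h2) fun s3 h3 => ?_
  refine wp_block_assign rfl (hsz 0 (by omega)) ?_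
  have h4 := h3.setReg4 0
  refine wp_block_cons (wp_innerVertexLoop hin hB hq (by omega) ?_ hNB h4) fun s5 h5 => ?_
  · simp only [List.length_append, List.length_singleton]
    omega
  refine wp_block_assign rfl (hsz 0 (by omega)) ?_
  have h6 := h5.setReg4 0
  have hl := length_flatMap_of_const es _ fun p => length_innerVertexWord G K s(p.1, p.2)
  -- the number of edges of the subdivision
  refine wp_block_cons (wp_pushAll_of_inv h6 (X := [K * es.length]) ?_ ?_ ?_ ?_ (h6.setWord _))
    fun s7 h7 => ?_
  · intro e he
    rw [List.mem_singleton.1 he]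
    exact (AExp.stable_const _).mul (AExp.stable_reg (by decide))
  · simp only [List.map_cons, List.map_nil, AExp.eval_mul, AExp.eval_const]
    rw [AExp.eval_reg]
    exact congrArg (fun x => [K * x]) h6.reg2
  · intro v hv
    rw [List.mem_singleton.1 hv]
    exact hsz _ (by omega)
  · simp only [List.length_append, List.length_singleton, hl]
    omega
  refine wp_block_cons (wp_pathEdgeLoop hin hB hq0 (by omega) ?_ hNB h7) fun s8 h8 => ?_
  · simp only [List.length_append, List.length_singleton, hl]
    omega
  -- the answer of the oracle
  have hword : s8.getWord 1 3 = queryWord G K r q vs es := by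
    rw [← Mem.setWord_eq_self h8.length h8.output, Mem.getWord_setWord, queryWord]
    simp
  have hD := hB.denom
  have hnum := G.prMatching_num_le (by omega : 2 ≤ K) r hq0
  have hden := G.prMatching_den_le (by omega : 2 ≤ K) r hq0
  have hmul := G.prMatching_num_mul (by omega : 2 ≤ K) r hq0
  rw [← hp] at hnum hden hmul
  refine wp_block_cons (P := fun s' => s' = s8.setWord 2 9 [p.num.toNat, p.den]) ?_ fun s9 h9 => ?_
  · refine ⟨?_, ?_⟩
    · rw [← hword] at hN
      simpa [Mem.getWord] using hN
    rw [hword, hO]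
    refine ⟨by simp only [List.length_cons, List.length_nil]; omega,
      hsz 2 (by omega), ?_, rfl⟩
    intro v hv
    simp only [List.mem_cons, List.not_mem_nil, or_false] at hv
    rcases hv with rfl | rfl
    · exact (Nat.size_le_size hnum).trans hD
    · exact (Nat.size_le_size hden).trans hD
  have hr6 : s9.reg 6 = q := by rw [h9, ← h8.reg6]; simp [Mem.setWord]
  have hr7 : s9.reg 7 = (2 ^ r) ^ es.length := by rw [h9, ← h8.reg7]; simp [Mem.setWord]
  have hr8 : s9.reg 8 = pathDenom K r q ^ G.E.card := by
    rw [h9, hin.card_E, ← h8.reg8]; simp [Mem.setWord]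
  have ha0 : s9.arr 2 0 = p.num.toNat := by rw [h9]; simp [Mem.setWord]
  have ha1 : s9.arr 2 1 = p.den := by rw [h9]; simp [Mem.setWord]
  have hdiv : p.num.toNat * pathDenom K r q ^ G.E.card / p.den = G.pathWeight K r q := by
    rw [hmul, Nat.mul_div_cancel _ (Rat.den_pos _)]
  refine wp_block_assign (v := G.pathWeight K r q) ?_ ?_ ?_
  · rw [AExp.eval_div, AExp.eval_mul, AExp.eval_read, AExp.eval_read, AExp.eval_reg,
      AExp.eval_const, AExp.eval_const, ha0, ha1, hr8, hdiv]
  · exact (Nat.size_le_size (G.pathWeight_le (by omega) r q)).trans hD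
  have hcount := G.numMatchings_eq hK (q := q) (c := 2 ^ r) (p := p) (by rw [hr])
    (by rw [hin.card_E]; exact hq) (by rw [hp, hr])
  rw [← hr, hdiv] at hcount
  have hle : G.numMatchings ≤ q := by
    refine G.numMatchings_le.trans ?_
    rw [hq, hin.card_E]
    exact Nat.pow_le_pow_left (Nat.le_mul_of_pos_left _ (by positivity)) _
  refine wp_block_store (k := 0) (v := G.numMatchings) rfl ?_
    ((Nat.size_le_size hle).trans hB.modulus) ?_
  · have h9' : (s9.setReg 9 (G.pathWeight K r q)).reg 9 = G.pathWeight K r q := by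
      simp [Mem.setReg]
    have h6' : (s9.setReg 9 (G.pathWeight K r q)).reg 6 = q := by simp [Mem.setReg, hr6]
    have h7' : (s9.setReg 9 (G.pathWeight K r q)).reg 7 = (2 ^ r) ^ G.E.card := by
      simp [Mem.setReg, hr7, hin.card_E]
    rw [← hcount, Nat.mod_eq_sub_div_mul]
    simp only [AExp.eval_div, AExp.eval_sub, AExp.eval_mul, AExp.eval_add, AExp.eval_reg,
      AExp.eval_const, h9', h6', h7']
  refine wp_block_assign rfl hs1 ?_
  simp [block, wp, Mem.getWord, Mem.setReg, Mem.setEntry, AExp.eval_const]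

/-! ### Resource bounds -/

/-- A bound for the number of passes of the loops and the length of the query. -/
noncomputable def countBound (K : ℕ) : Polynomial ℕ := .X + .C (5 * K) * .X + 2

/-- A bound for the bit length of all numbers that occur in the computation. -/
noncomputable def sizeBound (K : ℕ) : Polynomial ℕ :=
  (3 * .X + 2) * .C K * .X + 4 * .X + .C (2 * K + 2) + countBound K

theorem eval_countBound (K n : ℕ) : (countBound K).eval n = n + 5 * K * n + 2 := by
  simp [countBound]

theorem eval_sizeBound (K n : ℕ) :
    (sizeBound K).eval n = (3 * n + 2) * K * n + 4 * n + (2 * K + 2) + (n + 5 * K * n + 2) := by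
  simp [sizeBound, eval_countBound]

theorem length_le_wordSize (w : List ℕ) : w.length ≤ wordSize w := by
  induction w with
  | nil => simp
  | cons a w ih => simp only [wordSize, List.map_cons, List.sum_cons, List.length_cons] at *; omega

theorem size_lt_wordSize {w : List ℕ} {v : ℕ} (hv : v ∈ w) : v.size < wordSize w :=
  Nat.lt_of_succ_le
    (List.single_le_sum (fun _ _ => Nat.zero_le _) _
      (List.mem_map_of_mem (f := fun a => a.size + 1) hv))

theorem pair_lt_two_pow {a b k : ℕ} (ha : a < 2 ^ k) (hb : b < 2 ^ k) :
    Nat.pair a b < 2 ^ (2 * k) := by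
  refine (Nat.pair_lt_max_add_one_sq a b).trans_le ?_
  rw [mul_comm, pow_mul]
  exact Nat.pow_le_pow_left (Nat.succ_le_of_lt (max_lt ha hb)) 2

theorem pathDenom_le (K r : ℕ) {q : ℕ} (hq : 0 < q) : pathDenom K r q ≤ (4 * q) ^ K := by
  rw [pathDenom]
  refine (prod_le_prod' (g := fun _ => 4 * q) fun i _ => ?_).trans (by simp)
  unfold chosenWeight unchosenWeight
  split_ifs <;> omega

theorem IsInput.length_add_two_le {w : List ℕ} {G : FinGraph} {vs : List ℕ} {es : List (ℕ × ℕ)}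
    (hin : IsInput w G vs es) : vs.length + 2 * es.length + 2 ≤ wordSize w := by
  refine le_trans (Eq.le ?_) (length_le_wordSize w)
  rw [hin.eq]
  simp only [List.length_append, List.length_cons,
    length_flatMap_of_const es (fun p => [p.1, p.2]) (k := 2) fun _ => rfl]
  omega

/-- All numbers in the computation have polynomially many bits. The quadratic term of the bound is
due to the common denominator, a product of `K * es.length` factors that are at most `4 * q`. -/
theorem fitsIn {K r q : ℕ} {w : List ℕ} {G : FinGraph} {vs : List ℕ} {es : List (ℕ × ℕ)}
    (hin : IsInput w G vs es) (hr : r ≤ 2) (hq : q = (2 ^ r * 2) ^ es.length) :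
    FitsIn ((sizeBound K).eval (wordSize w)) K r q w G := by
  rw [eval_sizeBound]
  set n := wordSize w with hn
  have hlen := hin.length_add_two_le
  rw [← hn] at hlen
  have hv : ∀ v ∈ G.V, v < 2 ^ n := by
    intro v hv
    refine Nat.size_le.1 (size_lt_wordSize ?_).le
    rw [← hin.toFinset_vs, List.mem_toFinset] at hv
    rw [hin.eq]
    simp [hv]
  have hfresh : G.freshBase ≤ 2 ^ n := by
    refine Nat.succ_le_of_lt ((Finset.sup_lt_iff ?_).2 hv)
    exact Nat.two_pow_pos n
  have hqle : q ≤ 2 ^ (3 * n) := by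
    rw [hq, ← pow_succ, ← pow_mul]
    exact Nat.pow_le_pow_right two_pos (Nat.mul_le_mul (by omega) (by omega))
  have hq0 : 0 < q := hq ▸ pow_pos (by positivity) _
  have hD : pathDenom K r q ^ G.E.card ≤ 2 ^ ((3 * n + 2) * K * n) := by
    rw [pow_mul, pow_mul, hin.card_E]
    refine (Nat.pow_le_pow_left ((pathDenom_le K r hq0).trans (Nat.pow_le_pow_left ?_ K)) _).trans
      (Nat.pow_le_pow_right (by positivity) (by omega))
    rw [pow_add]
    omega
  have hsize : ∀ {v k : ℕ}, v ≤ 2 ^ k → v.size ≤ k + 1 := fun {v k} hv =>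
    Nat.size_le.2 (hv.trans_lt (Nat.pow_lt_pow_right one_lt_two (Nat.lt_succ_self k)))
  have hmono : ∀ {a b : ℕ}, a ≤ b → 2 ^ a ≤ 2 ^ b := fun h => Nat.pow_le_pow_right two_pos h
  refine ⟨fun v hv => (size_lt_wordSize hv).le.trans (by omega), (hsize hfresh).trans (by omega),
    ?_, (hsize hqle).trans (by omega), (hsize hD).trans (by omega)⟩
  intro e he i hi
  have hinf : e.inf < 2 ^ n := hv _ (G.mem_V e he _ ((FinGraph.mem_iff_inf_sup e _).2 (.inl rfl)))
  have hsup : e.sup < 2 ^ n := hv _ (G.mem_V e he _ ((FinGraph.mem_iff_inf_sup e _).2 (.inr rfl)))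
  unfold FinGraph.pathVertex
  split_ifs with h0 hiK
  · exact (hsize hinf.le).trans (by omega)
  · have hp := pair_lt_two_pow hinf hsup
    have hp' : Nat.pair (Nat.pair e.inf e.sup) i < 2 ^ (2 * (2 * n + K)) :=
      pair_lt_two_pow (hp.trans_le (hmono (by omega)))
        (hiK.trans (Nat.lt_two_pow_self.trans_le (hmono (by omega))))
    have hf : G.freshBase ≤ 2 ^ (2 * (2 * n + K)) := hfresh.trans (hmono (by omega))
    refine (hsize (k := 2 * (2 * n + K) + 1) ?_).trans (by omega)
    rw [pow_succ]
    omega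
  · exact (hsize hsup.le).trans (by omega)

theorem FitsIn.bounded_initMem {B K r q : ℕ} {w : List ℕ} {G : FinGraph}
    (hB : FitsIn B K r q w G) (hw : w.length ≤ B) : (initMem w).Bounded B :=
  Mem.Bounded.setWord ⟨fun _ => by simp, fun _ _ => by simp⟩ 0 0 (size_le_of_le hw le_rfl) hB.input

theorem countMatching_reduces_to_prMatching_sub (K : ℕ) (hK : 7 ≤ K) (F : Set FinGraph) :
    PolyTimeTuringReduces (CountMatching F) (PrMatching {G | ∃ H ∈ F, G = H.sub K}) := by
  -- The last summand of the time bound accounts for the output, a single number.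
  refine ⟨reduction K ((K - 1) % 3),
    (reduction K ((K - 1) % 3)).timeFactor.comp (countBound K) * (sizeBound K + 1) +
      (sizeBound K + 1), fun O hO w o hw => ?_⟩
  obtain ⟨G, hG, ⟨vs, es, h1, h2, h3, h4, h5⟩, rfl⟩ := hw
  have hin : IsInput w G vs es := ⟨h1, h2, h3, h4, h5⟩
  set r := (K - 1) % 3 with hr
  set q := (2 ^ r * 2) ^ es.length with hq
  have hq0 : 0 < q := hq ▸ pow_pos (by positivity) _
  have hB := fitsIn (K := K) hin (show r ≤ 2 by omega) hq
  have hquery := hO (queryWord G K r q vs es) _ ⟨G.sub K, ⟨G, hG, rfl⟩, G.pathProb K r q,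
    fun e _ => ⟨G.pathProb_nonneg K r q e, G.pathProb_le_one K r q e⟩,
    encodesProbGraph_queryWord G (by omega) r hq0 h1 h2 h3 h4, rfl⟩
  have hwl := hin.length_add_two_le
  have hN : (queryWord G K r q vs es).length ≤ (countBound K).eval (wordSize w) := by
    rw [length_queryWord, eval_countBound]
    have e1 : es.length * (K - 1) ≤ es.length * K := Nat.mul_le_mul_left _ (Nat.sub_le K 1)
    have e2 : es.length * K ≤ wordSize w * K := Nat.mul_le_mul_right _ (by omega)
    have e3 : es.length * (4 * K) = 4 * (es.length * K) := by ring
    have e4 : 5 * K * wordSize w = 5 * (wordSize w * K) := by ring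
    omega
  have hNB : (countBound K).eval (wordSize w) ≤ (sizeBound K).eval (wordSize w) := by
    rw [eval_sizeBound, eval_countBound]
    omega
  have hwB : w.length ≤ (sizeBound K).eval (wordSize w) := by
    refine (length_le_wordSize w).trans (le_trans ?_ hNB)
    rw [eval_countBound]
    omega
  obtain ⟨s, t, hexec, ht, hs, hout⟩ := exists_exec_of_wp (reduction K r)
    (wp_reduction hK hr hq hin hB hN hNB rfl hquery) (hB.bounded_initMem hwB)
  refine ⟨s, t, hexec, hout, ?_⟩
  have ho : wordSize (s.getWord 0 0) ≤ 1 * ((sizeBound K).eval (wordSize w) + 1) := by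
    refine (wordSize_le fun v hv => ?_).trans_eq (by rw [hout, List.length_singleton])
    obtain ⟨i, -, rfl⟩ := List.mem_map.1 hv
    exact hs.2 0 i
  rw [hout, one_mul] at ho
  simp only [Polynomial.eval_add, Polynomial.eval_mul, Polynomial.eval_comp, Polynomial.eval_one]
  exact Nat.add_le_add ht ho

end MatchRed

theorem mainTheorem4 (K : ℕ) (hK : 7 ≤ K) (F : Set MatchRed.FinGraph) :
    MatchRed.PolyTimeTuringReduces (MatchRed.CountMatching F)
      (MatchRed.PrMatching {G | ∃ H ∈ F, G = H.sub K}) :=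
  MatchRed.countMatching_reduces_to_prMatching_sub K hK F
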